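/- Let $k\ge 1$ be an integer, $d=2k+1$, $\rho=\frac{d-1}{2}=k$ and $R>0$. For $\lambda\ge 0$ and $\chi\ge 0$ let $$\Phi_\lambda(\chi)=\frac{1}{|\mathbb S^{d-1}|}\int_{\mathbb S^{d-1}}\bigl(\cosh\chi-\langle\xi,\omega\rangle\sinh\chi\bigr)^{-\rho+i\lambda}\,d\sigma(\omega)$$ (independent of the choice of $\xi\in\mathbb S^{d-1}$) be the spherical function of the $d$-dimensional real hyperbolic space, let $$c(\lambda,\rho)=\frac{2^{\rho-i\lambda}\,\Gamma(i\lambda)\,\Gamma(\rho+\frac12)}{\Gamma\bigl(\frac{\rho+i\lambda}{2}\bigr)\Gamma\bigl(\frac{\rho+i\lambda}{2}+\frac12\bigr)}$$ be the Harish-Chandra function, and let the Dirichlet kernel be the inverse spherical transform of the indicator function of $[0,M]$, $$D_M^{(d)}(\chi)=\frac{2^{2\rho}}{2\pi R^d}\int_0^\infty \mathbf 1_{[0,M]}(\lambda)\,\Phi_\lambda(\chi)\,|c(\lambda,\rho)|^{-2}\,d\lambda .$$ Let $0<a<\infty$ and let $f\in C^\infty((0,a))$ be complex-valued. Assume that 1.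 for $m=0,\dots,k$ the limit $f^{(m)}(0^+)=\lim_{\chi\to0^+}f^{(m)}(\chi)$ exists and is finite (in particular, these limits may all be $0$); 2. $\lim_{\chi\to a^-}f^{(l)}(\chi)=0$ for $l=0,\dots,k-1$; 3. $f^{(k)}$ is Lebesgue integrable on $(0,a)$. Then $\chi\mapsto f(\chi)\,D_M^{(d)}(\chi)\,\sinh^{d-1}\chi$ is integrable on $(0,a)$ for every real $M$, and $$\lim_{M\to\infty}R^d\int_0^a f(\chi)\,D_M^{(d)}(\chi)\,\sinh^{d-1}\chi\,d\chi=f(0^+).$$ -/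

import Mathlib

open Set Filter Topology MeasureTheory
open scoped ContDiff

noncomputable section

namespace HypDirichlet

/-- The Minkowski form `[X, Y] = X₀ Y₀ - ∑ Xᵢ Yᵢ` on `ℝ × ℝ^d`. -/
def minkowskiForm {d : ℕ} (X Y : ℝ × EuclideanSpace ℝ (Fin d)) : ℝ :=
  X.1 * Y.1 - inner ℝ X.2 Y.2

/-- The point `(cosh χ, sinh χ ξ)` of the unit hyperboloid, in geodesic polar coordinates. -/
def polarPoint {d : ℕ} (χ : ℝ) (ξ : EuclideanSpace ℝ (Fin d)) : ℝ × EuclideanSpace ℝ (Fin d) :=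
  (Real.cosh χ, Real.sinh χ • ξ)

/-- `ρ = (d - 1) / 2`. -/
def rho (d : ℕ) : ℝ := ((d : ℝ) - 1) / 2

/-- The hyperbolic plane wave `[x, (1, η)] ^ (-ρ + i s)` with spectral parameter `s`. The base is a
positive real number when `x` lies on the upper sheet of the hyperboloid and `η` is a unit
vector. -/
def planeWave {d : ℕ} (s : ℝ) (x : ℝ × EuclideanSpace ℝ (Fin d))
    (η : EuclideanSpace ℝ (Fin d)) : ℂ :=
  (minkowskiForm x (1, η) : ℂ) ^ (-(rho d : ℂ) + Complex.I * (s : ℂ))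

/-- The spherical function `Φ_s(χ)`: the mean over the unit sphere `S^{d-1}`, with respect to its
surface measure, of the plane waves at the point at distance `χ` from the pole in the direction of
the first basis vector. By rotation invariance of the surface measure the direction is
immaterial. -/
def sphericalFunction (d : ℕ) [NeZero d] (s χ : ℝ) : ℂ :=
  ⨍ η : Metric.sphere (0 : EuclideanSpace ℝ (Fin d)) 1,
    planeWave s (polarPoint χ (EuclideanSpace.single 0 1)) (η : EuclideanSpace ℝ (Fin d))
      ∂((volume : Measure (EuclideanSpace ℝ (Fin d))).toSphere)

/-- The Harish-Chandra function
`c(s, ρ) = 2^(ρ - i s) Γ(i s) Γ(ρ + 1/2) / (Γ((ρ + i s)/2) Γ((ρ + i s)/2 + 1/2))`. -/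
def cFunction (d : ℕ) (s : ℝ) : ℂ :=
  (2 : ℂ) ^ ((rho d : ℂ) - Complex.I * (s : ℂ)) * Complex.Gamma (Complex.I * (s : ℂ))
      * Complex.Gamma ((rho d : ℂ) + 1 / 2)
    / (Complex.Gamma (((rho d : ℂ) + Complex.I * (s : ℂ)) / 2)
      * Complex.Gamma (((rho d : ℂ) + Complex.I * (s : ℂ)) / 2 + 1 / 2))

/-- The inverse spherical (Fourier-Helgason) transform on the hyperbolic space of curvature
`-1/R²`: `g ↦ 2^(2ρ) / (2π R^d) ∫_0^∞ g(s) Φ_s(χ) |c(s, ρ)|⁻² ds`. -/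
def inverseTransform (d : ℕ) [NeZero d] (R : ℝ) (g : ℝ → ℂ) (χ : ℝ) : ℂ :=
  (((2 : ℝ) ^ (2 * rho d) / (2 * Real.pi * R ^ d) : ℝ) : ℂ) *
    ∫ s in Ioi (0 : ℝ), g s * sphericalFunction d s χ * (((‖cFunction d s‖ ^ 2)⁻¹ : ℝ) : ℂ)

/-- The Dirichlet kernel `D_M^{(d)}(χ)`: the inverse spherical transform of the indicator function
of `[0, M]`. -/
def dirichletKernel (d : ℕ) [NeZero d] (R M χ : ℝ) : ℂ :=
  inverseTransform d R ((Icc (0 : ℝ) M).indicator fun _ => 1) χ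

end HypDirichlet

end

noncomputable section

/-! In odd dimension d = 2k+1 the Plancherel-weighted spherical function Φ_λ |c(λ)|⁻² is, up to a
constant, what k applications of the operator -(sinh χ)⁻¹ d/dχ make of cos(λχ). Each application
beyond the first raises the dimension by two and produces a factor λ² + i². These are the factors of
the Plancherel density, which is a polynomial because ρ is an integer (`hasDerivAt_iteratedCosine`,
`inv_norm_cFunction_sq`, `sphericalFunction_mul_inv_norm_cFunction_sq`).

Integration against f sinh^(2k) moves these operators onto f by parts. The boundary terms vanish at
0 because of an odd power of sinh, and at a because the derivatives of f of order below k tend to 0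
there. The step from m+1 to m replaces A by (2m+1) cosh · A + sinh · A', so it multiplies the value
at 0⁺ by 2m+1 and costs one derivative. What remains is the cosine transform of an integrable g with
g(x) - 1·3···(2k-1) f(0⁺) = O(x) (`exists_cosine_transform`).

Integrating a cosine transform over [0, M] gives the kernel sin(Mx)/x, and the limit is (π/2) g(0⁺)
by the Riemann-Lebesgue lemma (`tendsto_integral_integral_cos`). The product of odd numbers cancels
against the normalization of the Dirichlet kernel. -/

namespace HypDirichlet

/-! ### Cosine transforms and their inversion at the endpoint 0. -/

/-- Fubini for an integrable function times a bounded continuous kernel. -/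
lemma setIntegral_mul_intervalIntegral_swap {s : Set ℝ} (hs : MeasurableSet s) {g : ℝ → ℂ}
    (hg : IntegrableOn g s) {K : ℝ → ℝ → ℂ} (hK : Continuous (Function.uncurry K)) {B M : ℝ}
    (hB : ∀ l ∈ uIoc 0 M, ∀ x ∈ s, ‖K l x‖ ≤ B) :
    ∫ l in (0 : ℝ)..M, ∫ x in s, g x * K l x = ∫ x in s, g x * ∫ l in (0 : ℝ)..M, K l x := by
  have h1 : Integrable (fun z : ℝ × ℝ => g z.2)
      ((volume.restrict (uIoc 0 M)).prod (volume.restrict s)) := by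
    have : IsFiniteMeasure (volume.restrict (uIoc 0 M)) := ⟨by simp [uIoc]⟩
    exact Integrable.comp_snd hg _
  have h2 : Integrable (Function.uncurry fun l x => g x * K l x)
      ((volume.restrict (uIoc 0 M)).prod (volume.restrict s)) := by
    refine h1.mul_bdd (c := B) hK.aestronglyMeasurable ?_
    rw [Measure.prod_restrict]
    filter_upwards [ae_restrict_mem (measurableSet_uIoc.prod hs)] with z hz
    exact hB z.1 hz.1 z.2 hz.2
  rw [intervalIntegral_integral_swap h2]
  simp [intervalIntegral.integral_const_mul]

/-- The Riemann-Lebesgue lemma for the sine transform on a half-line. -/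
lemma tendsto_integral_mul_sin {h : ℝ → ℂ} (hh : IntegrableOn h (Ioi 0)) :
    Tendsto (fun M : ℝ => ∫ x in Ioi (0 : ℝ), h x * (Real.sin (M * x) : ℂ)) atTop (𝓝 0) := by
  set F : ℝ → ℂ := (Ioi (0 : ℝ)).indicator h with hF
  have hFi : Integrable F := hh.integrable_indicator measurableSet_Ioi
  have hRL := Real.tendsto_integral_exp_smul_cocompact F
  have t1 : Tendsto (fun M : ℝ => M / (2 * Real.pi)) atTop (cocompact ℝ) :=
    (tendsto_id.atTop_div_const (by positivity)).mono_right atTop_le_cocompact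
  have t2 : Tendsto (fun M : ℝ => -(M / (2 * Real.pi))) atTop (cocompact ℝ) :=
    (tendsto_neg_atTop_atBot.comp
      (tendsto_id.atTop_div_const (by positivity))).mono_right atBot_le_cocompact
  -- The sine is the difference of the exponentials at frequencies -M/(2π) and M/(2π), divided by
  -- 2i.
  have key := ((hRL.comp t2).sub (hRL.comp t1)).div_const (2 * Complex.I)
  simp only [sub_zero, zero_div] at key
  refine key.congr fun M => ?_
  have hint : ∀ w : ℝ, Integrable fun v : ℝ => Real.fourierChar (-(v * w)) • F v := fun w => by
    have := (Real.fourierIntegral_convergent_iff (μ := volume) (f := F) w).2 hFi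
    simpa [mul_comm] using this
  simp only [Function.comp]
  rw [← integral_sub (hint _) (hint _), ← integral_div, ← integral_indicator measurableSet_Ioi]
  congr 1
  ext v
  have e1 : ∀ w : ℝ, Real.fourierChar (-(v * w)) • F v
      = Complex.exp (-(2 * Real.pi * w * v * Complex.I)) * F v := fun w => by
    rw [Circle.smul_def, Real.fourierChar_apply, smul_eq_mul]
    congr 2
    push_cast
    ring
  rw [e1, e1]
  by_cases hv : v ∈ Ioi (0 : ℝ)
  · rw [indicator_of_mem hv, hF, indicator_of_mem hv]
    have p : (Real.pi : ℂ) ≠ 0 := by exact_mod_cast Real.pi_ne_zero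
    have a1 : (2 * Real.pi * ((-(M / (2 * Real.pi)) : ℝ) : ℂ) * v * Complex.I)
        = -((M * v : ℂ) * Complex.I) := by
      push_cast
      field_simp
    have a2 : (2 * Real.pi * (((M / (2 * Real.pi)) : ℝ) : ℂ) * v * Complex.I)
        = (M * v : ℂ) * Complex.I := by
      push_cast
      field_simp
    rw [a1, a2, neg_neg, Complex.ofReal_sin, Complex.sin]
    push_cast
    field_simp
    ring_nf
    simp
    ring
  · simp [hv, hF]

/-- A model function with value 1 at 0: its transform integrates to arctan M, whose limit is the
constant π/2 of the inversion formula. -/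
lemma integral_exp_neg_mul_cos (l : ℝ) :
    ∫ x in Ioi (0 : ℝ), (Real.exp (-x) : ℂ) * (Real.cos (l * x) : ℂ)
      = ((1 / (1 + l ^ 2) : ℝ) : ℂ) := by
  have hre : ∀ s : ℝ, (-1 + s * Complex.I : ℂ).re < 0 := fun s => by simp
  have hi : ∀ s : ℝ, IntegrableOn (fun x : ℝ => Complex.exp ((-1 + s * Complex.I) * x)) (Ioi 0) :=
    fun s => integrableOn_exp_mul_complex_Ioi (hre s) 0
  have hv : ∀ s : ℝ, ∫ x in Ioi (0 : ℝ), Complex.exp ((-1 + s * Complex.I) * x)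
      = -1 / (-1 + s * Complex.I) := fun s => by
    rw [integral_exp_mul_complex_Ioi (hre s)]
    simp
  have e : (fun x : ℝ => (Real.exp (-x) : ℂ) * (Real.cos (l * x) : ℂ)) = fun x : ℝ =>
      (Complex.exp ((-1 + (l : ℝ) * Complex.I) * x)
        + Complex.exp ((-1 + ((-l : ℝ) : ℂ) * Complex.I) * x)) / 2 := by
    ext x
    rw [Complex.ofReal_cos, Complex.cos, Complex.ofReal_exp, add_mul, add_mul, Complex.exp_add,
      Complex.exp_add]
    push_cast
    ring_nf
  rw [e, integral_div, integral_add (hi _) (hi _), hv, hv]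
  have n1 : (-1 + l * Complex.I : ℂ) ≠ 0 := fun h => by simpa using congrArg Complex.re h
  have n2 : (-1 + ((-l : ℝ) : ℂ) * Complex.I : ℂ) ≠ 0 := fun h => by
    simpa using congrArg Complex.re h
  have n3 : (1 + l ^ 2 : ℂ) ≠ 0 := by
    have : (1 + l ^ 2 : ℝ) ≠ 0 := by positivity
    exact_mod_cast this
  have hm : (-1 + l * Complex.I) * (-1 + ((-l : ℝ) : ℂ) * Complex.I) = (1 + l ^ 2 : ℂ) := by
    push_cast
    linear_combination -(l : ℂ) ^ 2 * Complex.I_sq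
  rw [div_add_div _ _ n1 n2, hm]
  push_cast
  rw [div_div, div_eq_div_iff (by simpa using n3) n3]
  ring

lemma intervalIntegral_cos_mul (M : ℝ) {x : ℝ} (hx : x ≠ 0) :
    ∫ l in (0 : ℝ)..M, (Real.cos (l * x) : ℂ) = (Real.sin (M * x) : ℂ) / x := by
  rw [intervalIntegral.integral_ofReal]
  have : ∫ l in (0 : ℝ)..M, Real.cos (l * x) = Real.sin (M * x) / x := by
    rw [intervalIntegral.integral_comp_mul_right (fun y => Real.cos y) hx]
    simp [div_eq_inv_mul]
  rw [this]
  push_cast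
  rfl

/-- Fubini is applied before the division by x, so h(x)/x need not be integrable here. -/
lemma integral_mul_cos_eq_integral_div_mul_sin {h : ℝ → ℂ} (hh : IntegrableOn h (Ioi 0)) (M : ℝ) :
    ∫ l in (0 : ℝ)..M, ∫ x in Ioi (0 : ℝ), h x * (Real.cos (l * x) : ℂ)
      = ∫ x in Ioi (0 : ℝ), h x / x * (Real.sin (M * x) : ℂ) := by
  rw [setIntegral_mul_intervalIntegral_swap measurableSet_Ioi hh (B := 1)
    (K := fun l x => (Real.cos (l * x) : ℂ))]
  · refine setIntegral_congr_fun measurableSet_Ioi fun x hx => ?_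
    simp only [intervalIntegral_cos_mul M (ne_of_gt hx)]
    ring
  · exact Complex.continuous_ofReal.comp (Real.continuous_cos.comp
      (continuous_fst.mul continuous_snd))
  · intro l _ x _
    rw [Complex.norm_real]
    exact Real.abs_cos_le_one _

/-- Pointwise inversion of the cosine transform at the endpoint `0`, under a Lipschitz condition. -/
lemma tendsto_integral_integral_cos {a : ℝ} (ha : 0 < a) {g : ℝ → ℂ} (hg : IntegrableOn g (Ioo 0 a))
    {L : ℂ} {C δ : ℝ} (hδ : 0 < δ) (hL : ∀ x ∈ Ioo 0 δ, ‖g x - L‖ ≤ C * x) :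
    Tendsto (fun M : ℝ => ∫ l in (0 : ℝ)..M, ∫ x in Ioo 0 a, g x * (Real.cos (l * x) : ℂ)) atTop
      (𝓝 (Real.pi / 2 * L)) := by
  have hexp : IntegrableOn (fun x : ℝ => (Real.exp (-x) : ℂ)) (Ioi 0) :=
    Integrable.ofReal (f := fun x : ℝ => Real.exp (-x)) (integrableOn_exp_neg_Ioi 0)
  set G : ℝ → ℂ := (Ioo 0 a).indicator g with hG
  have hGi : IntegrableOn G (Ioi 0) := (hg.integrable_indicator measurableSet_Ioo).integrableOn
  -- Subtracting the model L e^(-x) removes the value at 0⁺. The Lipschitz bound then makes h(x)/x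
  -- bounded near 0, hence integrable, and its sine transform tends to 0.
  set h : ℝ → ℂ := fun x => G x - L * (Real.exp (-x) : ℂ) with hh
  have hhi : IntegrableOn h (Ioi 0) := hGi.sub (hexp.const_mul L)
  have hmul : ∀ {u : ℝ → ℂ}, IntegrableOn u (Ioi 0) → ∀ l : ℝ,
      IntegrableOn (fun x => u x * (Real.cos (l * x) : ℂ)) (Ioi 0) := fun hu l => by
    refine hu.mul_bdd (c := 1) (by fun_prop) (Eventually.of_forall fun x => ?_)
    rw [Complex.norm_real]
    exact Real.abs_cos_le_one _
  have hdiv : IntegrableOn (fun x => h x / x) (Ioi 0) := by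
    set η := min δ a with hη
    have hηp : 0 < η := lt_min hδ ha
    have hmeas : AEStronglyMeasurable (fun x => h x / x) (volume.restrict (Ioi (0 : ℝ))) := by
      have : AEStronglyMeasurable (fun x : ℝ => (x : ℂ)⁻¹) (volume.restrict (Ioi (0 : ℝ))) :=
        (Complex.measurable_ofReal.inv).aestronglyMeasurable
      exact (hhi.aestronglyMeasurable.mul this).congr (Eventually.of_forall fun x => rfl)
    have hsplit : Ioi (0 : ℝ) = Ioo 0 η ∪ Ici η := (Ioo_union_Ici_eq_Ioi hηp).symm
    rw [hsplit, integrableOn_union]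
    constructor
    · refine Integrable.of_bound (hmeas.mono_set Ioo_subset_Ioi_self) (C + ‖L‖) ?_
      filter_upwards [ae_restrict_mem measurableSet_Ioo] with x hx
      have hx0 : 0 < x := hx.1
      rw [norm_div, Complex.norm_real, Real.norm_of_nonneg hx0.le, div_le_iff₀ hx0]
      have hxa : x ∈ Ioo 0 a := ⟨hx0, hx.2.trans_le (min_le_right _ _)⟩
      have e : h x = (g x - L) + L * ((1 - Real.exp (-x) : ℝ) : ℂ) := by
        simp only [hh, hG, indicator_of_mem hxa]
        push_cast
        ring
      rw [e, add_mul]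
      refine (norm_add_le _ _).trans (add_le_add (hL x ⟨hx0, hx.2.trans_le (min_le_left _ _)⟩) ?_)
      rw [norm_mul, Complex.norm_real, Real.norm_of_nonneg]
      · have := Real.add_one_le_exp (-x)
        gcongr
        linarith
      · have := Real.exp_le_one_iff.2 (neg_nonpos.2 hx0.le)
        linarith
    · have hsub : Ici η ⊆ Ioi (0 : ℝ) := fun x hx => hηp.trans_le hx
      refine Integrable.mono' ((hhi.mono_set hsub).norm.mul_const η⁻¹) (hmeas.mono_set hsub) ?_
      filter_upwards [ae_restrict_mem measurableSet_Ici] with x hx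
      have hx0 : 0 < x := hηp.trans_le hx
      rw [norm_div, Complex.norm_real, Real.norm_of_nonneg hx0.le, div_eq_mul_inv]
      gcongr
      exact hx
  have hlim : Tendsto (fun M : ℝ => (∫ x in Ioi (0 : ℝ), h x / x * (Real.sin (M * x) : ℂ))
      + L * (Real.arctan M : ℂ)) atTop (𝓝 (0 + L * ((Real.pi / 2 : ℝ) : ℂ))) :=
    (tendsto_integral_mul_sin hdiv).add (((Complex.continuous_ofReal.tendsto _).comp
      (Real.tendsto_arctan_atTop.mono_right nhdsWithin_le_nhds)).const_mul L)
  have htarget : (0 + L * ((Real.pi / 2 : ℝ) : ℂ)) = Real.pi / 2 * L := by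
    push_cast
    ring
  rw [htarget] at hlim
  refine hlim.congr fun M => ?_
  rw [← integral_mul_cos_eq_integral_div_mul_sin hhi M]
  have e1 : ∀ l : ℝ, ∫ x in Ioi (0 : ℝ), h x * (Real.cos (l * x) : ℂ)
      = (∫ x in Ioo 0 a, g x * (Real.cos (l * x) : ℂ)) - L * ((1 / (1 + l ^ 2) : ℝ) : ℂ) := fun l => by
    rw [← integral_exp_neg_mul_cos, ← integral_const_mul,
      ← inter_eq_self_of_subset_right (Ioo_subset_Ioi_self : Ioo 0 a ⊆ Ioi (0 : ℝ)),
      ← setIntegral_indicator measurableSet_Ioo, ← integral_sub]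
    · congr 1
      ext x
      by_cases hx : x ∈ Ioo 0 a <;> simp [hh, hG, hx] <;> ring
    · have := hmul hGi l
      refine this.congr (Eventually.of_forall fun x => ?_)
      by_cases hx : x ∈ Ioo 0 a <;> simp [hG, hx]
    · exact (hmul hexp l).const_mul L
  have e2 : ∀ l : ℝ, ∫ x in Ioo 0 a, g x * (Real.cos (l * x) : ℂ)
      = (∫ x in Ioi (0 : ℝ), h x * (Real.cos (l * x) : ℂ)) + L * ((1 / (1 + l ^ 2) : ℝ) : ℂ) :=
    fun l => by rw [e1]; ring
  simp_rw [e2]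
  rw [intervalIntegral.integral_add, intervalIntegral.integral_const_mul,
    intervalIntegral.integral_ofReal, integral_one_div_one_add_sq]
  · simp
  · have hcont : Continuous fun l : ℝ => ∫ x in Ioi (0 : ℝ), h x * (Real.cos (l * x) : ℂ) := by
      refine continuous_of_dominated (bound := fun x => ‖h x‖)
        (fun l => (hmul hhi l).aestronglyMeasurable) (fun l => Eventually.of_forall fun x => ?_)
        hhi.norm (Eventually.of_forall fun x => by fun_prop)
      rw [norm_mul, Complex.norm_real]
      exact mul_le_of_le_one_right (norm_nonneg _) (Real.abs_cos_le_one _)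
    exact hcont.intervalIntegrable _ _
  · refine Continuous.intervalIntegrable ?_ _ _
    refine continuous_const.mul (Complex.continuous_ofReal.comp ?_)
    exact continuous_const.div (by fun_prop) fun l => by positivity

/-! ### Angular integrals and the iterated operator -(sinh χ)⁻¹ d/dχ. -/

/-- Differentiation under the integral sign over a compact interval, for a continuous derivative. -/
lemma hasDerivAt_intervalIntegral_of_continuous {F F' : ℝ → ℝ → ℂ}
    (hF : Continuous (Function.uncurry F)) (hF' : Continuous (Function.uncurry F'))
    (h : ∀ x t, HasDerivAt (fun y => F y t) (F' x t) x) (a b x : ℝ) :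
    HasDerivAt (fun y => ∫ t in a..b, F y t) (∫ t in a..b, F' x t) x := by
  obtain ⟨B, hB⟩ := ((isCompact_closedBall x 1).prod (isCompact_uIcc (a := a) (b := b))
    ).exists_bound_of_continuousOn hF'.continuousOn
  have hFc : ∀ y, Continuous (F y) := fun y => hF.comp (by fun_prop : Continuous fun t => (y, t))
  have hFc' : ∀ y, Continuous (F' y) := fun y => hF'.comp (by fun_prop : Continuous fun t => (y, t))
  refine (intervalIntegral.hasDerivAt_integral_of_dominated_loc_of_deriv_le (bound := fun _ => B)
    (Metric.closedBall_mem_nhds x one_pos) (Eventually.of_forall fun y => (hFc y).aestronglyMeasurable)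
    ((hFc x).intervalIntegrable _ _) (hFc' x).aestronglyMeasurable
    (Eventually.of_forall fun t ht y hy => hB (y, t) ⟨hy, uIoc_subset_uIcc ht⟩)
    (by simp) (Eventually.of_forall fun t _ y _ => h y t)).2

/-- The Minkowski product of the point at distance `χ` from the pole with a light-like vector making
the angle `θ` with its direction. -/
def horoBase (χ θ : ℝ) : ℝ := Real.cosh χ - Real.cos θ * Real.sinh χ

/-- By cosh² - cos²θ sinh² = 1 + sin²θ sinh² > 0, cosh dominates |cos θ sinh|. -/
lemma horoBase_pos (χ θ : ℝ) : 0 < horoBase χ θ := by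
  have h1 := Real.cosh_sq χ
  have h2 := Real.cosh_pos χ
  have h3 := Real.sin_sq_add_cos_sq θ
  have h4 : (Real.cos θ * Real.sinh χ) ^ 2 < Real.cosh χ ^ 2 := by
    nlinarith [sq_nonneg (Real.sin θ * Real.sinh χ)]
  have := abs_lt_of_sq_lt_sq h4 h2.le
  unfold horoBase
  linarith [(abs_lt.1 this).2, le_abs_self (Real.cos θ * Real.sinh χ)]

lemma continuous_horoBase : Continuous (Function.uncurry horoBase) := by
  unfold horoBase Function.uncurry
  fun_prop

/-- The complex power `horoBase χ θ ^ z`. -/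
def horoPow (z : ℂ) (χ θ : ℝ) : ℂ := Complex.exp (z * (Real.log (horoBase χ θ) : ℂ))

lemma horoPow_eq_cpow (z : ℂ) (χ θ : ℝ) : horoPow z χ θ = (horoBase χ θ : ℂ) ^ z := by
  rw [Complex.cpow_def_of_ne_zero (by exact_mod_cast (horoBase_pos χ θ).ne'), horoPow,
    Complex.ofReal_log (horoBase_pos χ θ).le, mul_comm]

lemma continuous_horoPow {X : Type*} [TopologicalSpace X] {z : X → ℂ} {c t : X → ℝ}
    (hz : Continuous z) (hc : Continuous c) (ht : Continuous t) :
    Continuous fun x => horoPow (z x) (c x) (t x) := by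
  unfold horoPow
  refine Complex.continuous_exp.comp (hz.mul (Complex.continuous_ofReal.comp ?_))
  exact (continuous_horoBase.comp (hc.prodMk ht)).log fun x => (horoBase_pos _ _).ne'

lemma horoPow_sub_one (z : ℂ) (χ θ : ℝ) :
    horoPow (z - 1) χ θ = horoPow z χ θ / (horoBase χ θ : ℂ) := by
  rw [horoPow, horoPow, sub_mul, Complex.exp_sub, one_mul, ← Complex.ofReal_exp,
    Real.exp_log (horoBase_pos χ θ)]

lemma horoPow_eq_horoBase_mul (z : ℂ) (χ θ : ℝ) :
    horoPow z χ θ = (horoBase χ θ : ℂ) * horoPow (z - 1) χ θ := by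
  have : (horoBase χ θ : ℂ) ≠ 0 := by exact_mod_cast (horoBase_pos χ θ).ne'
  rw [horoPow_sub_one]
  field_simp

lemma hasDerivAt_horoPow_comp {u : ℝ → ℝ × ℝ} {d x : ℝ} (z : ℂ)
    (h : HasDerivAt (fun y => horoBase (u y).1 (u y).2) d x) :
    HasDerivAt (fun y => horoPow z (u y).1 (u y).2) (z * d * horoPow (z - 1) (u x).1 (u x).2) x := by
  have h1 := (((h.log (horoBase_pos _ _).ne').ofReal_comp).const_mul z).cexp
  refine HasDerivAt.congr_deriv h1 ?_
  rw [horoPow_sub_one, horoPow]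
  push_cast
  ring

lemma hasDerivAt_horoPow_left (z : ℂ) (χ θ : ℝ) :
    HasDerivAt (fun y => horoPow z y θ)
      (z * ((Real.sinh χ - Real.cos θ * Real.cosh χ : ℝ) : ℂ) * horoPow (z - 1) χ θ) χ :=
  hasDerivAt_horoPow_comp (u := fun y => (y, θ)) z
    ((Real.hasDerivAt_cosh χ).sub ((Real.hasDerivAt_sinh χ).const_mul (Real.cos θ)))

lemma hasDerivAt_horoPow_right (z : ℂ) (χ θ : ℝ) :
    HasDerivAt (fun y => horoPow z χ y)
      (z * ((Real.sinh χ * Real.sin θ : ℝ) : ℂ) * horoPow (z - 1) χ θ) θ := by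
  refine hasDerivAt_horoPow_comp (u := fun y => (χ, y)) z ?_
  have := ((Real.hasDerivAt_cos θ).mul_const (Real.sinh χ)).const_sub (Real.cosh χ)
  exact HasDerivAt.congr_deriv this (by ring)

/-- Integration by parts in the angular variable. -/
lemma integral_horoPow_parts (z : ℂ) (n : ℕ) (χ : ℝ) :
    z * (Real.sinh χ : ℂ) * (∫ θ in (0 : ℝ)..Real.pi, horoPow (z - 1) χ θ * (Real.sin θ : ℂ) ^ (n + 3))
      + (n + 2) * ∫ θ in (0 : ℝ)..Real.pi, horoPow z χ θ * (Real.cos θ : ℂ) * (Real.sin θ : ℂ) ^ (n + 1)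
      = 0 := by
  -- The power sin^(n+2) vanishes at both 0 and π, so this primitive leaves no boundary term.
  have hd : ∀ θ ∈ uIcc (0 : ℝ) Real.pi, HasDerivAt (fun y => horoPow z χ y * (Real.sin y : ℂ) ^ (n + 2))
      (z * (Real.sinh χ : ℂ) * (horoPow (z - 1) χ θ * (Real.sin θ : ℂ) ^ (n + 3))
        + (n + 2) * (horoPow z χ θ * (Real.cos θ : ℂ) * (Real.sin θ : ℂ) ^ (n + 1))) θ := fun θ _ => by
    have := (hasDerivAt_horoPow_right z χ θ).mul (((Real.hasDerivAt_sin θ).ofReal_comp).pow (n + 2))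
    refine HasDerivAt.congr_deriv this ?_
    simp
    ring
  have hc := continuous_horoPow (X := ℝ) (z := fun _ => z) continuous_const
    (continuous_const (y := χ)) continuous_id
  have hc1 := continuous_horoPow (X := ℝ) (z := fun _ => z - 1) continuous_const
    (continuous_const (y := χ)) continuous_id
  simp only [id] at hc hc1
  have i1 : Continuous fun θ : ℝ => z * (Real.sinh χ : ℂ) * (horoPow (z - 1) χ θ * (Real.sin θ : ℂ) ^ (n + 3)) := by
    fun_prop
  have i2 : Continuous fun θ : ℝ => (n + 2 : ℂ) * (horoPow z χ θ * (Real.cos θ : ℂ) * (Real.sin θ : ℂ) ^ (n + 1)) := by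
    fun_prop
  have := intervalIntegral.integral_eq_sub_of_hasDerivAt hd ((i1.add i2).intervalIntegrable _ _)
  rw [intervalIntegral.integral_add (i1.intervalIntegrable _ _) (i2.intervalIntegrable _ _),
    intervalIntegral.integral_const_mul, intervalIntegral.integral_const_mul] at this
  rw [this]
  simp

/-- Since sinh χ sin θ is the θ-derivative of `horoBase`, the integrand is exact. The base equals
e^χ at θ = π and e^(-χ) at θ = 0. -/
lemma integral_horoPow_mul_sin (z : ℂ) (χ : ℝ) :
    z * (Real.sinh χ : ℂ) * (∫ θ in (0 : ℝ)..Real.pi, horoPow (z - 1) χ θ * (Real.sin θ : ℂ))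
      = Complex.exp (z * χ) - Complex.exp (-(z * χ)) := by
  have hc1 := continuous_horoPow (X := ℝ) (z := fun _ => z - 1) continuous_const
    (continuous_const (y := χ)) continuous_id
  simp only [id] at hc1
  have := intervalIntegral.integral_eq_sub_of_hasDerivAt
    (fun θ (_ : θ ∈ uIcc (0 : ℝ) Real.pi) => hasDerivAt_horoPow_right z χ θ)
    (Continuous.intervalIntegrable (by fun_prop) _ _)
  have e : ∀ θ : ℝ, z * ((Real.sinh χ * Real.sin θ : ℝ) : ℂ) * horoPow (z - 1) χ θ
      = z * (Real.sinh χ : ℂ) * (horoPow (z - 1) χ θ * (Real.sin θ : ℂ)) := fun θ => by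
    push_cast
    ring
  simp_rw [e] at this
  rw [intervalIntegral.integral_const_mul] at this
  rw [this]
  have b1 : horoBase χ Real.pi = Real.exp χ := by
    rw [horoBase, Real.cos_pi, ← Real.cosh_add_sinh]
    ring
  have b0 : horoBase χ 0 = Real.exp (-χ) := by
    rw [horoBase, Real.cos_zero, ← Real.cosh_sub_sinh]
    ring
  rw [horoPow, horoPow, b1, b0, Real.log_exp, Real.log_exp]
  push_cast
  ring_nf

/-- The angular integral representing, up to normalization, the spherical function of the real
hyperbolic space of dimension `2 * j + 3`. -/
def angularIntegral (j : ℕ) (l χ : ℝ) : ℂ :=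
  ∫ θ in (0 : ℝ)..Real.pi, horoPow (-(j + 1 : ℂ) + Complex.I * l) χ θ * (Real.sin θ : ℂ) ^ (2 * j + 1)

lemma continuous_angularIntegral (j : ℕ) :
    Continuous (Function.uncurry (angularIntegral j)) := by
  unfold angularIntegral Function.uncurry
  refine intervalIntegral.continuous_parametric_intervalIntegral_of_continuous' ?_ _ _
  unfold Function.uncurry
  have := continuous_horoPow (X := (ℝ × ℝ) × ℝ)
    (z := fun p => -(j + 1 : ℂ) + Complex.I * (p.1.1 : ℂ)) (c := fun p => p.1.2) (t := fun p => p.2)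
    (by fun_prop) (by fun_prop) (by fun_prop)
  fun_prop

/-- The derivative of the base is sinh χ sin²θ - cos θ · `horoBase χ θ`. The first term already has
two more powers of the sine, and `integral_horoPow_parts` brings the second to the same form. With z
= -(j+1) + il the constant comes from z(z + 2(j+1)) = -(l² + (j+1)²). -/
lemma hasDerivAt_angularIntegral (j : ℕ) (l χ : ℝ) :
    HasDerivAt (angularIntegral j l)
      (-((l ^ 2 + (j + 1) ^ 2) / (2 * (j + 1))) * (Real.sinh χ : ℂ) * angularIntegral (j + 1) l χ) χ := by
  set z : ℂ := -(j + 1 : ℂ) + Complex.I * l with hz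
  have hc := continuous_horoPow (X := ℝ × ℝ) (z := fun _ => z) continuous_const
    continuous_fst continuous_snd
  have hc1 := continuous_horoPow (X := ℝ × ℝ) (z := fun _ => z - 1) continuous_const
    continuous_fst continuous_snd
  have key := hasDerivAt_intervalIntegral_of_continuous
    (F := fun χ θ => horoPow z χ θ * (Real.sin θ : ℂ) ^ (2 * j + 1))
    (F' := fun χ θ => z * ((Real.sinh χ - Real.cos θ * Real.cosh χ : ℝ) : ℂ)
      * horoPow (z - 1) χ θ * (Real.sin θ : ℂ) ^ (2 * j + 1))
    (by unfold Function.uncurry; fun_prop) (by unfold Function.uncurry; fun_prop)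
    (fun x t => (hasDerivAt_horoPow_left z x t).mul_const _) 0 Real.pi χ
  have hfun : angularIntegral j l
      = fun y => ∫ θ in (0 : ℝ)..Real.pi, horoPow z y θ * (Real.sin θ : ℂ) ^ (2 * j + 1) := by
    ext y
    rw [angularIntegral]
  rw [hfun]
  refine key.congr_deriv ?_
  have hd : Continuous fun θ : ℝ => horoPow z χ θ :=
    continuous_horoPow continuous_const continuous_const continuous_id
  have hd1 : Continuous fun θ : ℝ => horoPow (z - 1) χ θ :=
    continuous_horoPow continuous_const continuous_const continuous_id
  have e : ∀ θ : ℝ, z * ((Real.sinh χ - Real.cos θ * Real.cosh χ : ℝ) : ℂ)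
      * horoPow (z - 1) χ θ * (Real.sin θ : ℂ) ^ (2 * j + 1)
      = z * (Real.sinh χ : ℂ) * (horoPow (z - 1) χ θ * (Real.sin θ : ℂ) ^ (2 * j + 3))
        - z * (horoPow z χ θ * (Real.cos θ : ℂ) * (Real.sin θ : ℂ) ^ (2 * j + 1)) := fun θ => by
    rw [horoPow_eq_horoBase_mul z χ θ, horoBase]
    have hs : (Real.sin θ : ℂ) ^ 2 + (Real.cos θ : ℂ) ^ 2 = 1 := by
      exact_mod_cast Real.sin_sq_add_cos_sq θ
    push_cast at hs ⊢
    linear_combination (-z * Complex.sinh χ * horoPow (z - 1) χ θ * Complex.sin θ ^ (2 * j + 1)) * hs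
  simp_rw [e]
  rw [intervalIntegral.integral_sub, intervalIntegral.integral_const_mul,
    intervalIntegral.integral_const_mul]
  rotate_left
  · exact Continuous.intervalIntegrable (by fun_prop) _ _
  · exact Continuous.intervalIntegrable (by fun_prop) _ _
  have hp := integral_horoPow_parts z (2 * j) χ
  have hz1 : (-((j + 1 : ℕ) + 1 : ℂ) + Complex.I * l) = z - 1 := by
    rw [hz]
    push_cast
    ring
  rw [angularIntegral, hz1, show 2 * (j + 1) + 1 = 2 * j + 3 by ring]
  set X := ∫ θ in (0 : ℝ)..Real.pi, horoPow (z - 1) χ θ * (Real.sin θ : ℂ) ^ (2 * j + 3)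
  set Y := ∫ θ in (0 : ℝ)..Real.pi, horoPow z χ θ * (Real.cos θ : ℂ) * (Real.sin θ : ℂ) ^ (2 * j + 1)
  have hj : (2 * (j + 1) : ℂ) ≠ 0 := by exact_mod_cast (by positivity : (2 * (j + 1) : ℕ) ≠ 0)
  have hY : Y = -(z * (Real.sinh χ : ℂ) * X) / (2 * (j + 1)) := by
    rw [eq_div_iff hj]
    rw [Nat.cast_mul, Nat.cast_ofNat] at hp
    linear_combination hp
  have hzz : z * (z + 2 * (j + 1)) = -(l ^ 2 + (j + 1) ^ 2) := by
    rw [hz]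
    linear_combination (l : ℂ) ^ 2 * Complex.I_sq
  rw [hY]
  have hj2 : (j + 1 : ℂ) ≠ 0 := right_ne_zero_of_mul hj
  field_simp
  linear_combination X * (Real.sinh χ : ℂ) * hzz

/-- The functions obtained from `cos (l χ)` by applying `-(sinh χ)⁻¹ d/dχ` repeatedly. -/
def iteratedCosine : ℕ → ℝ → ℝ → ℂ
  | 0, l, χ => (Real.cos (l * χ) : ℂ)
  | j + 1, l, χ => (l : ℂ) ^ 2 / 2
      * (∏ i ∈ Finset.range j, ((l : ℂ) ^ 2 + (i + 1) ^ 2) / (2 * (i + 1))) * angularIntegral j l χ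

lemma continuous_iteratedCosine (j : ℕ) : Continuous (Function.uncurry (iteratedCosine j)) := by
  cases j with
  | zero =>
    unfold Function.uncurry iteratedCosine
    fun_prop
  | succ j =>
    have := continuous_angularIntegral j
    unfold Function.uncurry at this ⊢
    unfold iteratedCosine
    refine Continuous.mul (Continuous.mul (by fun_prop) (continuous_finsetProd _ fun i _ => ?_)) this
    fun_prop

/-- For j = 0 this is sin(lχ) = (l/2) sinh χ · `angularIntegral 0 l χ`, the three-dimensional case.
Afterwards each derivative of the angular integral supplies the next factor of the product. -/
lemma hasDerivAt_iteratedCosine (j : ℕ) (l χ : ℝ) :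
    HasDerivAt (iteratedCosine j l) (-((Real.sinh χ : ℂ) * iteratedCosine (j + 1) l χ)) χ := by
  cases j with
  | zero =>
    have h : HasDerivAt (fun y : ℝ => Real.cos (l * y)) (-Real.sin (l * χ) * l) χ := by
      simpa using ((hasDerivAt_id χ).const_mul l).cos
    refine HasDerivAt.congr_deriv h.ofReal_comp ?_
    have hI := integral_horoPow_mul_sin (Complex.I * l) χ
    have e : (-((0 : ℕ) + 1 : ℂ) + Complex.I * l) = Complex.I * l - 1 := by
      push_cast
      ring
    simp only [iteratedCosine, angularIntegral, Finset.range_zero, Finset.prod_empty, mul_one, e,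
      mul_zero, zero_add, pow_one]
    set X := ∫ θ in (0 : ℝ)..Real.pi, horoPow (Complex.I * l - 1) χ θ * (Real.sin θ : ℂ)
    push_cast at hI ⊢
    rw [Complex.sin]
    have e1 : -(l * χ : ℂ) * Complex.I = -(Complex.I * l * χ) := by ring
    have e2 : (l * χ : ℂ) * Complex.I = Complex.I * l * χ := by ring
    rw [e1, e2]
    linear_combination (-Complex.I * l / 2) * hI + ((l : ℂ) ^ 2 * Complex.sinh χ * X / 2) * Complex.I_sq
  | succ j =>
    have h := (hasDerivAt_angularIntegral j l χ).const_mul ((l : ℂ) ^ 2 / 2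
      * (∏ i ∈ Finset.range j, ((l : ℂ) ^ 2 + (i + 1) ^ 2) / (2 * (i + 1))))
    refine HasDerivAt.congr_deriv h ?_
    simp only [iteratedCosine, Finset.prod_range_succ]
    ring

/-! ### Spherical means of zonal functions, from a Gaussian integral computed in two ways. -/

/-- In polar coordinates the integral of `F (‖x‖⁻¹ • x) * h ‖x‖` factors into an integral over the
sphere and a radial integral. -/
lemma integral_direction_mul_norm {E : Type*} [NormedAddCommGroup E] [NormedSpace ℝ E]
    [FiniteDimensional ℝ E] [Nontrivial E] [MeasurableSpace E] [BorelSpace E] (μ : Measure E)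
    [μ.IsAddHaarMeasure] (F : E → ℂ) (h : ℝ → ℂ) :
    ∫ x, F (‖x‖⁻¹ • x) * h ‖x‖ ∂μ = (∫ η : Metric.sphere (0 : E) 1, F η ∂μ.toSphere)
      * ∫ r : Ioi (0 : ℝ), h r ∂(Measure.volumeIoiPow (Module.finrank ℝ E - 1)) := by
  rw [← integral_prod_mul]
  calc
    _ = ∫ x : ({(0)}ᶜ : Set E), F (‖x.1‖⁻¹ • x.1) * h ‖x.1‖ ∂(μ.comap (↑)) := by
      rw [integral_subtype_comap (measurableSet_singleton _).compl
        fun x : E => F (‖x‖⁻¹ • x) * h ‖x‖, restrict_compl_singleton]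
    _ = _ := by
      simpa using μ.measurePreserving_homeomorphUnitSphereProd.integral_comp
        (Homeomorph.measurableEmbedding _) (fun z => F (z.1 : E) * h (z.2 : ℝ))

/-- First computation: polar coordinates split off a radial factor independent of F. -/
lemma integral_gaussian_zonal_eq_sphere (n : ℕ) (F : ℝ → ℂ) :
    ∫ x : EuclideanSpace ℝ (Fin (n + 2)), F (x 0 / ‖x‖) * (Real.exp (-‖x‖ ^ 2) : ℂ)
      = (∫ η : Metric.sphere (0 : EuclideanSpace ℝ (Fin (n + 2))) 1,
            F ((η : EuclideanSpace ℝ (Fin (n + 2))) 0)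
              ∂(volume : Measure (EuclideanSpace ℝ (Fin (n + 2)))).toSphere)
        * ∫ r : Ioi (0 : ℝ), (Real.exp (-(r : ℝ) ^ 2) : ℂ) ∂(Measure.volumeIoiPow
            (Module.finrank ℝ (EuclideanSpace ℝ (Fin (n + 2))) - 1)) := by
  rw [← integral_direction_mul_norm volume
    (fun x : EuclideanSpace ℝ (Fin (n + 2)) => F (x 0)) (fun r => (Real.exp (-r ^ 2) : ℂ))]
  simp [div_eq_inv_mul]

/-- Splitting off the first coordinate of a Euclidean space is measure preserving. -/
lemma measurePreserving_splitFirst (n : ℕ) :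
    MeasurePreserving (fun x : EuclideanSpace ℝ (Fin (n + 2)) =>
      ((x 0, WithLp.toLp 2 fun j : Fin (n + 1) => x j.succ) : ℝ × EuclideanSpace ℝ (Fin (n + 1)))) := by
  have h1 := PiLp.volume_preserving_ofLp (Fin (n + 2))
  have h2 := volume_preserving_piFinSuccAbove (fun _ : Fin (n + 2) => ℝ) 0
  have h3 := (MeasurePreserving.id (volume : Measure ℝ)).prod (PiLp.volume_preserving_toLp (Fin (n + 1)))
  exact (h3.comp h2).comp h1

lemma norm_eq_sqrt_splitFirst {n : ℕ} (x : EuclideanSpace ℝ (Fin (n + 2))) :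
    ‖x‖ = √(x 0 ^ 2 + ‖(WithLp.toLp 2 fun j : Fin (n + 1) => x j.succ :
      EuclideanSpace ℝ (Fin (n + 1)))‖ ^ 2) := by
  rw [EuclideanSpace.norm_eq, EuclideanSpace.real_norm_sq_eq, Fin.sum_univ_succ]
  simp

/-- The profile `(u, s) ↦ F (u / √(u² + s²)) exp (-(u² + s²))`. -/
def zonalGaussian (F : ℝ → ℂ) (u s : ℝ) : ℂ :=
  F (u / √(u ^ 2 + s ^ 2)) * (Real.exp (-(u ^ 2 + s ^ 2)) : ℂ)

lemma measurable_zonalGaussian {F : ℝ → ℂ} (hF : Measurable F) :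
    Measurable (Function.uncurry (zonalGaussian F)) := by
  unfold zonalGaussian Function.uncurry
  exact (hF.comp (by fun_prop)).mul (by fun_prop)

lemma norm_zonalGaussian_le {F : ℝ → ℂ} {B : ℝ} (hB : ∀ t ∈ Icc (-1 : ℝ) 1, ‖F t‖ ≤ B) (u s : ℝ) :
    ‖zonalGaussian F u s‖ ≤ B * (Real.exp (-u ^ 2) * Real.exp (-s ^ 2)) := by
  rw [zonalGaussian, norm_mul, Complex.norm_real, Real.norm_of_nonneg (Real.exp_pos _).le,
    ← Real.exp_add, neg_add]
  refine mul_le_mul_of_nonneg_right (hB _ ?_) (Real.exp_pos _).le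
  have h : |u| ≤ √(u ^ 2 + s ^ 2) := Real.abs_le_sqrt (by nlinarith [sq_nonneg s])
  rw [mem_Icc, ← abs_le, abs_div, abs_of_nonneg (Real.sqrt_nonneg _)]
  exact div_le_one_of_le₀ h (Real.sqrt_nonneg _)

lemma integrable_exp_neg_norm_sq (n : ℕ) :
    Integrable fun y : EuclideanSpace ℝ (Fin n) => Real.exp (-‖y‖ ^ 2) := by
  have := GaussianFourier.integrable_cexp_neg_mul_sq_norm_add (V := EuclideanSpace ℝ (Fin n)) (b := 1) (by simp) 0 0
  have h2 := this.norm
  refine h2.congr (Eventually.of_forall fun y => ?_)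
  simp [Complex.norm_exp, ← Complex.ofReal_pow]

lemma integrableOn_pow_mul_exp_neg_sq (n : ℕ) :
    IntegrableOn (fun s : ℝ => s ^ n * Real.exp (-s ^ 2)) (Ioi 0) := by
  have := integrable_rpow_mul_exp_neg_mul_sq (b := 1) one_pos (s := n) (by
    have : (0 : ℝ) ≤ n := n.cast_nonneg
    linarith)
  simpa using this.integrableOn

/-- Second computation: with u the first coordinate and y the others, the integrand depends only on
u and s = ‖y‖. Integrating out the direction of y leaves the weight s^n on a half-plane. -/
lemma integral_gaussian_zonal_eq_halfPlane (n : ℕ) {F : ℝ → ℂ} (hF : Measurable F) {B : ℝ}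
    (hB : ∀ t ∈ Icc (-1 : ℝ) 1, ‖F t‖ ≤ B) :
    ∫ x : EuclideanSpace ℝ (Fin (n + 2)), F (x 0 / ‖x‖) * (Real.exp (-‖x‖ ^ 2) : ℂ)
      = ((n + 1 : ℕ) * (volume : Measure (EuclideanSpace ℝ (Fin (n + 1)))).real (Metric.ball 0 1) : ℝ)
        * ∫ p in univ ×ˢ Ioi (0 : ℝ), (p.2 : ℂ) ^ n * zonalGaussian F p.1 p.2 := by
  set E' := EuclideanSpace ℝ (Fin (n + 1))
  have hm : Measurable fun z : ℝ × E' => zonalGaussian F z.1 ‖z.2‖ :=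
    (measurable_zonalGaussian hF).comp (measurable_fst.prodMk measurable_snd.norm)
  have hu : Integrable fun u : ℝ => Real.exp (-u ^ 2) := by
    simpa using integrable_exp_neg_mul_sq one_pos
  have hi : Integrable fun z : ℝ × E' => zonalGaussian F z.1 ‖z.2‖ := by
    refine Integrable.mono' ((hu.mul_prod (integrable_exp_neg_norm_sq (n + 1))).const_mul B)
      hm.aestronglyMeasurable (Eventually.of_forall fun z => ?_)
    exact norm_zonalGaussian_le hB _ _
  have hi2 : IntegrableOn (fun p : ℝ × ℝ => (p.2 : ℂ) ^ n * zonalGaussian F p.1 p.2)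
      (univ ×ˢ Ioi (0 : ℝ)) := by
    rw [IntegrableOn, Measure.volume_eq_prod, ← Measure.prod_restrict, Measure.restrict_univ]
    refine Integrable.mono' ((hu.mul_prod (integrableOn_pow_mul_exp_neg_sq n)).const_mul B)
      ?_ ?_
    · have := measurable_zonalGaussian hF
      exact (Measurable.mul (by fun_prop) this).aestronglyMeasurable
    · rw [← Measure.restrict_univ (μ := (volume : Measure ℝ)), Measure.prod_restrict]
      filter_upwards [ae_restrict_mem (MeasurableSet.univ.prod measurableSet_Ioi)] with p hp
      have hp2 : 0 < p.2 := hp.2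
      rw [norm_mul, norm_pow, Complex.norm_real, Real.norm_of_nonneg hp2.le]
      calc p.2 ^ n * ‖zonalGaussian F p.1 p.2‖
          ≤ p.2 ^ n * (B * (Real.exp (-p.1 ^ 2) * Real.exp (-p.2 ^ 2))) := by
            gcongr
            exact norm_zonalGaussian_le hB _ _
        _ = _ := by ring
  calc
    _ = ∫ x : EuclideanSpace ℝ (Fin (n + 2)), (fun z : ℝ × E' => zonalGaussian F z.1 ‖z.2‖)
          (x 0, WithLp.toLp 2 fun j : Fin (n + 1) => x j.succ) := by
      congr 1
      ext x
      simp only [zonalGaussian]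
      rw [norm_eq_sqrt_splitFirst x, Real.sq_sqrt (by positivity)]
    _ = ∫ z : ℝ × E', zonalGaussian F z.1 ‖z.2‖ := by
      have hmp := measurePreserving_splitFirst n
      rw [← hmp.map_eq, integral_map hmp.aemeasurable hm.aestronglyMeasurable]
    _ = ∫ u : ℝ, ∫ y : E', zonalGaussian F u ‖y‖ := integral_prod _ hi
    _ = ∫ u : ℝ, (((n + 1 : ℕ) * (volume : Measure E').real (Metric.ball 0 1) : ℝ) : ℂ)
          * ∫ s in Ioi (0 : ℝ), (s : ℂ) ^ n * zonalGaussian F u s := by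
      congr 1
      ext u
      rw [integral_fun_norm_addHaar volume (fun s => zonalGaussian F u s), finrank_euclideanSpace_fin]
      simp [E', mul_assoc]
    _ = _ := by
      rw [integral_const_mul, Measure.volume_eq_prod, setIntegral_prod, setIntegral_univ]
      exact hi2

lemma integral_halfPlane_eq_polar (n : ℕ) (F : ℝ → ℂ) :
    ∫ p in univ ×ˢ Ioi (0 : ℝ), (p.2 : ℂ) ^ n * zonalGaussian F p.1 p.2
      = (∫ r in Ioi (0 : ℝ), (r : ℂ) ^ (n + 1) * (Real.exp (-r ^ 2) : ℂ))
        * ∫ θ in (0 : ℝ)..Real.pi, (Real.sin θ : ℂ) ^ n * F (Real.cos θ) := by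
  rw [← integral_indicator (MeasurableSet.univ.prod measurableSet_Ioi), ← integral_comp_polarCoord_symm,
    polarCoord_target, intervalIntegral.integral_of_le Real.pi_pos.le, integral_Ioc_eq_integral_Ioo,
    ← setIntegral_prod_mul, ← Measure.volume_eq_prod,
    ← integral_indicator (measurableSet_Ioi.prod measurableSet_Ioo),
    ← integral_indicator (measurableSet_Ioi.prod measurableSet_Ioo)]
  congr 1
  ext ⟨r, θ⟩
  by_cases hr : r ∈ Ioi (0 : ℝ)
  · by_cases hθ : θ ∈ Ioo (-Real.pi) Real.pi
    · by_cases h0 : 0 < θ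
      · have hs : 0 < Real.sin θ := Real.sin_pos_of_pos_of_lt_pi h0 hθ.2
        have hrs : 0 < r * Real.sin θ := mul_pos (mem_Ioi.1 hr) hs
        have hsq : (r * Real.cos θ) ^ 2 + (r * Real.sin θ) ^ 2 = r ^ 2 := by
          nlinarith [Real.sin_sq_add_cos_sq θ]
        rw [indicator_of_mem (mk_mem_prod hr hθ), indicator_of_mem (mk_mem_prod hr (mem_Ioo.2 ⟨h0, hθ.2⟩)), polarCoord_symm_apply,
          indicator_of_mem (mk_mem_prod (mem_univ _) (mem_Ioi.2 hrs))]
        simp only [zonalGaussian, hsq, Real.sqrt_sq (mem_Ioi.1 hr).le]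
        rw [mul_div_cancel_left₀ _ (mem_Ioi.1 hr).ne', Complex.real_smul]
        push_cast
        ring
      -- Angles in (-π, 0] land outside the open half-plane, so only (0, π) contributes.
      · have hs : ¬ 0 < r * Real.sin θ := by
          have : Real.sin θ ≤ 0 := Real.sin_nonpos_of_nonpos_of_neg_pi_le (not_lt.1 h0) hθ.1.le
          nlinarith [mem_Ioi.1 hr]
        rw [indicator_of_mem (mk_mem_prod hr hθ), polarCoord_symm_apply, indicator_of_notMem, indicator_of_notMem,
          smul_zero]
        · exact fun h => h0 h.2.1
        · exact fun h => hs h.2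
    · rw [indicator_of_notMem fun h => hθ h.2, indicator_of_notMem]
      exact fun h => hθ ⟨by linarith [h.2.1, Real.pi_pos], h.2.2⟩
  · rw [indicator_of_notMem fun h => hr h.1, indicator_of_notMem fun h => hr h.1]

lemma integral_sin_pow_ne_zero (n : ℕ) : (∫ θ in (0 : ℝ)..Real.pi, (Real.sin θ : ℂ) ^ n) ≠ 0 := by
  have := (integral_sin_pow_pos (n := n)).ne'
  have e : (∫ θ in (0 : ℝ)..Real.pi, (Real.sin θ : ℂ) ^ n)
      = ((∫ θ in (0 : ℝ)..Real.pi, Real.sin θ ^ n : ℝ) : ℂ) := by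
    rw [← intervalIntegral.integral_ofReal]
    simp
  rw [e]
  exact_mod_cast this

/-- The spherical mean of a zonal function. -/
lemma average_sphere_zonal (n : ℕ) {F : ℝ → ℂ} (hF : Measurable F) {B : ℝ}
    (hB : ∀ t ∈ Icc (-1 : ℝ) 1, ‖F t‖ ≤ B) :
    ⨍ η : Metric.sphere (0 : EuclideanSpace ℝ (Fin (n + 2))) 1,
        F ((η : EuclideanSpace ℝ (Fin (n + 2))) 0)
          ∂(volume : Measure (EuclideanSpace ℝ (Fin (n + 2)))).toSphere
      = (∫ θ in (0 : ℝ)..Real.pi, (Real.sin θ : ℂ) ^ n * F (Real.cos θ))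
        / ∫ θ in (0 : ℝ)..Real.pi, (Real.sin θ : ℂ) ^ n := by
  set σ := (volume : Measure (EuclideanSpace ℝ (Fin (n + 2)))).toSphere with hσ
  have e1 := (integral_gaussian_zonal_eq_sphere n F).symm.trans
    ((integral_gaussian_zonal_eq_halfPlane n hF hB).trans
      (congrArg _ (integral_halfPlane_eq_polar n F)))
  -- The case F = 1 carries the same radial and ball-volume constants, which cancel in the quotient
  -- and need not be evaluated.
  have e2 := (integral_gaussian_zonal_eq_sphere n fun _ => 1).symm.trans
    ((integral_gaussian_zonal_eq_halfPlane n measurable_const (B := 1) (by simp)).trans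
      (congrArg _ (integral_halfPlane_eq_polar n fun _ => 1)))
  have e3 : (∫ x : EuclideanSpace ℝ (Fin (n + 2)), (Real.exp (-‖x‖ ^ 2) : ℂ)) ≠ 0 := by
    rw [integral_complex_ofReal]
    have := integral_exp_pos (μ := volume) (f := fun x : EuclideanSpace ℝ (Fin (n + 2)) => -‖x‖ ^ 2)
      (integrable_exp_neg_norm_sq _)
    exact_mod_cast this.ne'
  have e4 := integral_gaussian_zonal_eq_sphere n fun _ => 1
  simp only [one_mul] at e4
  rw [e4] at e3
  simp only [mul_one] at e2
  rw [average_eq, Complex.real_smul]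
  simp only [integral_const, mul_one, Complex.real_smul] at e1 e2 e3 ⊢
  set c1 := ∫ r : Ioi (0 : ℝ), (Real.exp (-(r : ℝ) ^ 2) : ℂ) ∂(Measure.volumeIoiPow
            (Module.finrank ℝ (EuclideanSpace ℝ (Fin (n + 2))) - 1))
  set c2 := ∫ r in Ioi (0 : ℝ), (r : ℂ) ^ (n + 1) * (Real.exp (-r ^ 2) : ℂ)
  set W := ∫ θ in (0 : ℝ)..Real.pi, (Real.sin θ : ℂ) ^ n
  set I := ∫ θ in (0 : ℝ)..Real.pi, (Real.sin θ : ℂ) ^ n * F (Real.cos θ)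
  have hW : W ≠ 0 := integral_sin_pow_ne_zero n
  have hc1 : c1 ≠ 0 := right_ne_zero_of_mul e3
  have hs := left_ne_zero_of_mul e3
  push_cast
  rw [inv_mul_eq_div, div_eq_div_iff hs hW]
  apply mul_right_cancel₀ hc1
  linear_combination W * e1 - I * e2

/-! ### Regularity classes and repeated integration by parts. -/

/-- Functions on `(0, a)` with `m` derivatives, all of which have limits at `0`, which vanish at `a`
up to order `m - 1`, and whose `m`-th derivative is continuous and integrable. -/
def RegularUpTo (a : ℝ) : ℕ → (ℝ → ℂ) → Prop
  | 0, A => ContinuousOn A (Ioo 0 a) ∧ (∃ L, Tendsto A (𝓝[>] 0) (𝓝 L)) ∧ IntegrableOn A (Ioo 0 a)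
  | m + 1, A => (∃ L, Tendsto A (𝓝[>] 0) (𝓝 L)) ∧ Tendsto A (𝓝[<] a) (𝓝 0) ∧
      ∃ A', (∀ x ∈ Ioo 0 a, HasDerivAt A (A' x) x) ∧ RegularUpTo a m A'

namespace RegularUpTo

variable {a : ℝ} {m : ℕ} {A B : ℝ → ℂ}

lemma exists_tendsto (h : RegularUpTo a m A) : ∃ L, Tendsto A (𝓝[>] 0) (𝓝 L) := by
  cases m with
  | zero => exact h.2.1
  | succ m => exact h.1

lemma continuousOn (h : RegularUpTo a m A) : ContinuousOn A (Ioo 0 a) := by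
  cases m with
  | zero => exact h.1
  | succ m =>
    obtain ⟨-, -, A', hA', -⟩ := h
    exact fun x hx => (hA' x hx).continuousAt.continuousWithinAt

lemma integrableOn (h : RegularUpTo a m A) : IntegrableOn A (Ioo 0 a) := by
  cases m with
  | zero => exact h.2.2
  | succ m =>
    have hc := h.continuousOn
    obtain ⟨⟨L, hL⟩, ha, -⟩ := h
    have h1 := (continuousOn_Icc_extendFrom_Ioo hc hL ha).integrableOn_Icc (μ := volume)
    exact (h1.mono_set Ioo_subset_Icc_self).congr_fun (extendFrom_extends hc) measurableSet_Ioo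

lemma add (hA : RegularUpTo a m A) (hB : RegularUpTo a m B) :
    RegularUpTo a m (fun x => A x + B x) := by
  induction m generalizing A B with
  | zero =>
    obtain ⟨hAc, ⟨LA, hLA⟩, hAi⟩ := hA
    obtain ⟨hBc, ⟨LB, hLB⟩, hBi⟩ := hB
    exact ⟨hAc.add hBc, ⟨_, hLA.add hLB⟩, hAi.add hBi⟩
  | succ m ih =>
    obtain ⟨⟨LA, hLA⟩, hA0, A', hA', hAr⟩ := hA
    obtain ⟨⟨LB, hLB⟩, hB0, B', hB', hBr⟩ := hB
    exact ⟨⟨_, hLA.add hLB⟩, by simpa using hA0.add hB0, _,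
      fun x hx => (hA' x hx).add (hB' x hx), ih hAr hBr⟩

lemma pred (hA : RegularUpTo a (m + 1) A) : RegularUpTo a m A := by
  induction m generalizing A with
  | zero => exact ⟨hA.continuousOn, hA.1, hA.integrableOn⟩
  | succ m ih =>
    obtain ⟨hL, h0, A', hA', hAr⟩ := hA
    exact ⟨hL, h0, A', hA', ih hAr⟩

lemma smooth_mul {h : ℝ → ℂ} (hh : ContDiff ℝ ∞ h) (hA : RegularUpTo a m A) :
    RegularUpTo a m (fun x => h x * A x) := by
  have ht : ∀ u : ℝ → ℂ, ContDiff ℝ ∞ u → ∀ (c : ℝ) (s : Set ℝ), Tendsto u (𝓝[s] c) (𝓝 (u c)) :=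
    fun u hu c s => hu.continuous.continuousAt.tendsto.mono_left nhdsWithin_le_nhds
  induction m generalizing A h with
  | zero =>
    obtain ⟨hAc, ⟨LA, hLA⟩, hAi⟩ := hA
    exact ⟨hh.continuous.continuousOn.mul hAc, ⟨_, (ht h hh _ _).mul hLA⟩,
      hAi.continuousOn_mul_of_subset hh.continuous.continuousOn isCompact_Icc measurableSet_Ioo
        Ioo_subset_Icc_self⟩
  | succ m ih =>
    have hp := hA.pred
    obtain ⟨⟨LA, hLA⟩, h0, A', hA', hAr⟩ := hA
    have hd : ContDiff ℝ ∞ (deriv h) := ((contDiff_infty_iff_deriv).1 hh).2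
    refine ⟨⟨_, (ht h hh _ _).mul hLA⟩, by simpa using (ht h hh a _).mul h0, fun x => deriv h x * A x + h x * A' x,
      fun x hx => ?_, (ih hd hp).add (ih hh hAr)⟩
    exact ((hh.differentiable (by simp)) x).hasDerivAt.mul (hA' x hx)

/-- A' has a limit at 0⁺, so it is bounded there. The mean value inequality on [y, x] gives the
bound as y → 0⁺. -/
lemma isBigO_sub (ha : 0 < a) (hA : RegularUpTo a (m + 1) A) {L : ℂ} (hL : Tendsto A (𝓝[>] 0) (𝓝 L)) :
    (fun x => A x - L) =O[𝓝[>] 0] fun x : ℝ => x := by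
  obtain ⟨-, -, A', hA', hAr⟩ := hA
  obtain ⟨L', hL'⟩ := hAr.exists_tendsto
  have hb : ∀ᶠ x in 𝓝[>] (0 : ℝ), ‖A' x‖ < ‖L'‖ + 1 := hL'.norm.eventually_lt_const (by linarith)
  obtain ⟨δ, hδ, hδb⟩ := mem_nhdsGT_iff_exists_Ioo_subset.1 (inter_mem hb (Ioo_mem_nhdsGT ha))
  refine Asymptotics.IsBigO.of_bound (‖L'‖ + 1) ?_
  filter_upwards [Ioo_mem_nhdsGT hδ] with x hx
  have hx0 : 0 < x := hx.1
  have hlim : Tendsto (fun y => ‖A x - A y‖) (𝓝[>] 0) (𝓝 ‖A x - L‖) := (hL.const_sub _).norm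
  refine le_of_tendsto hlim ?_
  filter_upwards [Ioo_mem_nhdsGT hx0] with y hy
  have := (convex_Ioo (0 : ℝ) δ).norm_image_sub_le_of_norm_hasDerivWithin_le
    (fun z hz => (hA' z (hδb hz).2).hasDerivWithinAt) (fun z hz => (hδb hz).1.le)
    (⟨hy.1, hy.2.trans hx.2⟩ : y ∈ Ioo 0 δ) hx
  refine this.trans ?_
  have h1 : ‖x - y‖ ≤ ‖x‖ := by
    rw [Real.norm_of_nonneg (by linarith [hy.2]), Real.norm_of_nonneg hx0.le]
    linarith [hy.1]
  gcongr

end RegularUpTo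

lemma contDiff_ofReal_sinh : ContDiff ℝ ∞ fun x : ℝ => (Real.sinh x : ℂ) :=
  Complex.ofRealCLM.contDiff.comp Real.contDiff_sinh

lemma contDiff_ofReal_cosh : ContDiff ℝ ∞ fun x : ℝ => (Real.cosh x : ℂ) :=
  Complex.ofRealCLM.contDiff.comp Real.contDiff_cosh

/-- Moving the operator `-(sinh χ)⁻¹ d/dχ` from `iteratedCosine` to the other factor. -/
lemma integral_mul_sinh_pow_mul_iteratedCosine {a : ℝ} (ha : 0 < a) {m : ℕ} {A A' : ℝ → ℂ} {L : ℂ}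
    (hL : Tendsto A (𝓝[>] 0) (𝓝 L)) (h0 : Tendsto A (𝓝[<] a) (𝓝 0))
    (hA' : ∀ x ∈ Ioo 0 a, HasDerivAt A (A' x) x) (hAi : IntegrableOn A (Ioo 0 a))
    (hAi' : IntegrableOn A' (Ioo 0 a)) (l : ℝ) :
    ∫ x in Ioo 0 a, A x * (Real.sinh x : ℂ) ^ (2 * (m + 1)) * iteratedCosine (m + 1) l x
      = ∫ x in Ioo 0 a, ((2 * m + 1) * (Real.cosh x : ℂ) * A x + (Real.sinh x : ℂ) * A' x)
          * (Real.sinh x : ℂ) ^ (2 * m) * iteratedCosine m l x := by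
  have hH : ∀ j, Continuous (iteratedCosine j l) := fun j =>
    (continuous_iteratedCosine j).comp (Continuous.prodMk_right l)
  have hm := hH m
  have hm1 := hH (m + 1)
  have hmul : ∀ {u h : ℝ → ℂ}, IntegrableOn u (Ioo 0 a) → Continuous h →
      IntegrableOn (fun x => u x * h x) (Ioo 0 a) := fun hu hh =>
    hu.mul_continuousOn_of_subset hh.continuousOn measurableSet_Ioo isCompact_Icc Ioo_subset_Icc_self
  have i1 : IntegrableOn (fun x => A x * (Real.sinh x : ℂ) ^ (2 * (m + 1)) * iteratedCosine (m + 1) l x)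
      (Ioo 0 a) := hmul (hmul hAi (by fun_prop)) hm1
  have i2 : IntegrableOn (fun x => ((2 * m + 1) * (Real.cosh x : ℂ) * A x + (Real.sinh x : ℂ) * A' x)
      * (Real.sinh x : ℂ) ^ (2 * m) * iteratedCosine m l x) (Ioo 0 a) := by
    refine hmul (hmul (Integrable.add ?_ ?_) (by fun_prop)) hm
    · simpa only [mul_comm, IntegrableOn] using hmul hAi (h := fun x : ℝ => (2 * m + 1) * (Real.cosh x : ℂ)) (by fun_prop)
    · simpa only [mul_comm, IntegrableOn] using hmul hAi' (h := fun x : ℝ => (Real.sinh x : ℂ)) (by fun_prop)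
  have hd : ∀ x ∈ Ioo 0 a, HasDerivAt
      (fun x => A x * ((Real.sinh x : ℂ) ^ (2 * m + 1) * iteratedCosine m l x))
      (((2 * m + 1) * (Real.cosh x : ℂ) * A x + (Real.sinh x : ℂ) * A' x)
          * (Real.sinh x : ℂ) ^ (2 * m) * iteratedCosine m l x
        - A x * (Real.sinh x : ℂ) ^ (2 * (m + 1)) * iteratedCosine (m + 1) l x) x := fun x hx => by
    have h1 := (hA' x hx).mul ((((Real.hasDerivAt_sinh x).ofReal_comp).pow (2 * m + 1)).mul
      (hasDerivAt_iteratedCosine m l x))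
    refine HasDerivAt.congr_deriv h1 ?_
    simp only [Pi.pow_apply, add_tsub_cancel_right, Nat.cast_add, Nat.cast_mul, Nat.cast_ofNat,
      Nat.cast_one, Pi.mul_apply]
    ring
  have hc : Continuous fun x : ℝ => (Real.sinh x : ℂ) ^ (2 * m + 1) * iteratedCosine m l x := by
    fun_prop
  -- At 0 the factor sinh^(2m+1) vanishes, even for m = 0. At a the factor A tends to 0.
  have t0 := hL.mul (hc.continuousAt.tendsto.mono_left (nhdsWithin_le_nhds (a := 0) (s := Ioi 0)))
  have ta := h0.mul (hc.continuousAt.tendsto.mono_left (nhdsWithin_le_nhds (a := a) (s := Iio a)))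
  have key := intervalIntegral.integral_eq_sub_of_hasDerivAt_of_tendsto ha hd
    ((intervalIntegrable_iff_integrableOn_Ioo_of_le ha.le).2 (i2.sub i1)) t0 ta
  rw [intervalIntegral.integral_of_le ha.le, integral_Ioc_eq_integral_Ioo, integral_sub i2 i1] at key
  simp only [Real.sinh_zero, Complex.ofReal_zero, ne_eq, Nat.add_eq_zero_iff, one_ne_zero, and_false,
    not_false_eq_true, zero_pow, zero_mul, mul_zero, sub_zero] at key
  exact (sub_eq_zero.1 key).symm

/-- After `m` integrations by parts only a cosine transform is left. -/
lemma exists_cosine_transform {a : ℝ} (ha : 0 < a) (m : ℕ) {A : ℝ → ℂ} {L : ℂ}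
    (hA : RegularUpTo a m A) (hL : Tendsto A (𝓝[>] 0) (𝓝 L))
    (hO : (fun x => A x - L) =O[𝓝[>] 0] fun x : ℝ => x) :
    ∃ g : ℝ → ℂ, IntegrableOn g (Ioo 0 a) ∧
      ((fun x => g x - (∏ i ∈ Finset.range m, (2 * i + 1 : ℂ)) * L) =O[𝓝[>] 0] fun x : ℝ => x) ∧
      ∀ l : ℝ, ∫ x in Ioo 0 a, A x * (Real.sinh x : ℂ) ^ (2 * m) * iteratedCosine m l x
        = ∫ x in Ioo 0 a, g x * (Real.cos (l * x) : ℂ) := by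
  induction m generalizing A L with
  | zero => exact ⟨A, hA.integrableOn, by simpa using hO, fun l => by simp [iteratedCosine]⟩
  | succ m ih =>
    have hp := hA.pred
    have hAi := hA.integrableOn
    obtain ⟨-, h0, A', hA', hAr⟩ := hA
    obtain ⟨L', hL'⟩ := hAr.exists_tendsto
    set B : ℝ → ℂ := fun x => (2 * m + 1) * (Real.cosh x : ℂ) * A x + (Real.sinh x : ℂ) * A' x with hB
    have hBr : RegularUpTo a m B :=
      (hp.smooth_mul (contDiff_const.mul contDiff_ofReal_cosh)).add (hAr.smooth_mul contDiff_ofReal_sinh)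
    have hsinh : (fun x : ℝ => (Real.sinh x : ℂ)) =O[𝓝[>] 0] fun x : ℝ => x := by
      have := ((Real.hasDerivAt_sinh 0).ofReal_comp.isBigO_sub).mono (nhdsWithin_le_nhds (s := Ioi 0))
      simpa using this
    have hcosh : (fun x : ℝ => (Real.cosh x : ℂ) - 1) =O[𝓝[>] 0] fun x : ℝ => x := by
      have := ((Real.hasDerivAt_cosh 0).ofReal_comp.isBigO_sub).mono (nhdsWithin_le_nhds (s := Ioi 0))
      simpa using this
    -- The O(x) bound is carried through the induction because at order 0 no derivative is left to
    -- yield it. Here sinh · A' is O(x) merely because A' is bounded near 0.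
    have hBO : (fun x => B x - (2 * m + 1) * L) =O[𝓝[>] 0] fun x : ℝ => x := by
      have e : (fun x => B x - (2 * m + 1) * L) = fun x : ℝ =>
          (2 * m + 1) * (((Real.cosh x : ℂ) - 1) * A x) + (2 * m + 1) * (A x - L)
            + (Real.sinh x : ℂ) * A' x := by
        ext x
        simp only [hB]
        ring
      rw [e]
      have h1 := hcosh.mul (hL.isBigO_one ℝ)
      have h2 := hsinh.mul (hL'.isBigO_one ℝ)
      simp only [mul_one] at h1 h2
      exact ((h1.const_mul_left _).add (hO.const_mul_left _)).add h2
    have hBL : Tendsto B (𝓝[>] 0) (𝓝 ((2 * m + 1) * L)) := by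
      have h1 : Tendsto (fun x : ℝ => x) (𝓝[>] 0) (𝓝 0) := nhdsWithin_le_nhds
      exact tendsto_sub_nhds_zero_iff.1 (hBO.trans_tendsto h1)
    obtain ⟨g, hgi, hgO, hg⟩ := ih hBr hBL hBO
    refine ⟨g, hgi, ?_, fun l => ?_⟩
    · simpa only [Finset.prod_range_succ, mul_assoc] using hgO
    · rw [← hg, integral_mul_sinh_pow_mul_iteratedCosine ha hL h0 hA' hAi hAr.integrableOn]

lemma regularUpTo_of_contDiffOn {a : ℝ} {k : ℕ} {f : ℝ → ℂ} (hf : ContDiffOn ℝ ∞ f (Ioo 0 a))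
    {L : ℕ → ℂ} (h_zero : ∀ m ≤ k, Tendsto (iteratedDeriv m f) (𝓝[>] 0) (𝓝 (L m)))
    (h_end : ∀ l < k, Tendsto (iteratedDeriv l f) (𝓝[<] a) (𝓝 0))
    (h_int : IntegrableOn (iteratedDeriv k f) (Ioo 0 a)) : RegularUpTo a k f := by
  have hs : ∀ j, ContDiffOn ℝ ∞ (iteratedDeriv j f) (Ioo 0 a) := fun j => by
    induction j with
    | zero => simpa using hf
    | succ j ih =>
      rw [iteratedDeriv_succ]
      exact ih.deriv_of_isOpen isOpen_Ioo (by simp)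
  suffices H : ∀ m j, j + m = k → RegularUpTo a m (iteratedDeriv j f) by
    simpa using H k 0 (zero_add k)
  intro m
  induction m with
  | zero =>
    rintro j rfl
    exact ⟨(hs _).continuousOn, ⟨_, h_zero _ le_rfl⟩, h_int⟩
  | succ m ih =>
    intro j hj
    refine ⟨⟨_, h_zero j (by omega)⟩, h_end j (by omega), iteratedDeriv (j + 1) f, fun x hx => ?_,
      ih (j + 1) (by omega)⟩
    rw [iteratedDeriv_succ]
    exact (((hs j).contDiffAt (isOpen_Ioo.mem_nhds hx)).differentiableAt (by simp)).hasDerivAt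

/-- Inversion formula for the transform with kernel `iteratedCosine k`. -/
lemma tendsto_integral_integral_iteratedCosine {a : ℝ} (ha : 0 < a) {k : ℕ} (hk : 1 ≤ k) {f : ℝ → ℂ}
    (hf : RegularUpTo a k f) {L : ℂ} (hL : Tendsto f (𝓝[>] 0) (𝓝 L)) :
    Tendsto (fun M : ℝ => ∫ x in Ioo 0 a, f x * (Real.sinh x : ℂ) ^ (2 * k)
        * ∫ l in (0 : ℝ)..M, iteratedCosine k l x) atTop
      (𝓝 (Real.pi / 2 * ((∏ i ∈ Finset.range k, (2 * i + 1 : ℂ)) * L))) := by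
  have hO : (fun x => f x - L) =O[𝓝[>] 0] fun x : ℝ => x := by
    -- At least one derivative with a limit at 0⁺ is needed for the initial O(x) bound.
    obtain ⟨m, rfl⟩ : ∃ m, k = m + 1 := ⟨k - 1, by omega⟩
    exact hf.isBigO_sub ha hL
  obtain ⟨g, hgi, hgO, hg⟩ := exists_cosine_transform ha k hf hL hO
  obtain ⟨C, hC⟩ := hgO.bound
  obtain ⟨δ, hδ, hδb⟩ := mem_nhdsGT_iff_exists_Ioo_subset.1 hC
  refine (tendsto_integral_integral_cos ha hgi hδ (C := C) fun x hx => ?_).congr fun M => ?_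
  · have := hδb hx
    simpa [abs_of_pos hx.1] using this
  · have hfi : IntegrableOn (fun x => f x * (Real.sinh x : ℂ) ^ (2 * k)) (Ioo 0 a) :=
      hf.integrableOn.mul_continuousOn_of_subset (Continuous.continuousOn (by fun_prop)) measurableSet_Ioo
        isCompact_Icc Ioo_subset_Icc_self
    obtain ⟨B, hB⟩ := ((isCompact_uIcc (a := (0 : ℝ)) (b := M)).prod
      (isCompact_Icc (a := (0 : ℝ)) (b := a))).exists_bound_of_continuousOn
      (continuous_iteratedCosine k).continuousOn
    rw [← setIntegral_mul_intervalIntegral_swap measurableSet_Ioo hfi (continuous_iteratedCosine k)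
      fun l hl x hx => hB (l, x) ⟨uIoc_subset_uIcc hl, Ioo_subset_Icc_self hx⟩]
    simp_rw [hg]

/-! ### The Plancherel density and a closed form of the Dirichlet kernel. -/

lemma rho_odd (k : ℕ) : rho (2 * k + 1) = k := by
  simp [rho]

lemma average_sphere_zonal_of_eq {d n : ℕ} [NeZero d] (h : d = n + 2) {F : ℝ → ℂ} (hF : Measurable F)
    {B : ℝ} (hB : ∀ t ∈ Icc (-1 : ℝ) 1, ‖F t‖ ≤ B) :
    ⨍ η : Metric.sphere (0 : EuclideanSpace ℝ (Fin d)) 1, F ((η : EuclideanSpace ℝ (Fin d)) 0)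
          ∂(volume : Measure (EuclideanSpace ℝ (Fin d))).toSphere
      = (∫ θ in (0 : ℝ)..Real.pi, (Real.sin θ : ℂ) ^ n * F (Real.cos θ))
        / ∫ θ in (0 : ℝ)..Real.pi, (Real.sin θ : ℂ) ^ n := by
  subst h
  exact average_sphere_zonal n hF hB

lemma planeWave_polarPoint_single {d : ℕ} [NeZero d] (s χ : ℝ) (η : EuclideanSpace ℝ (Fin d)) :
    planeWave s (polarPoint χ (EuclideanSpace.single 0 1)) η
      = ((Real.cosh χ - η 0 * Real.sinh χ : ℝ) : ℂ) ^ (-(rho d : ℂ) + Complex.I * (s : ℂ)) := by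
  simp [planeWave, polarPoint, minkowskiForm, inner_smul_left, EuclideanSpace.inner_single_left,
    mul_comm]

/-- The plane wave depends on η only through its first coordinate, so its mean is zonal. In
dimension 2j+3 one has ρ = j+1, and the sine has exponent d - 2 = 2j+1. -/
lemma sphericalFunction_eq_angularIntegral (j : ℕ) (s χ : ℝ) :
    sphericalFunction (2 * (j + 1) + 1) s χ
      = angularIntegral j s χ / ∫ θ in (0 : ℝ)..Real.pi, (Real.sin θ : ℂ) ^ (2 * j + 1) := by
  set z : ℂ := -(j + 1 : ℂ) + Complex.I * s with hz
  have hzr : -(rho (2 * (j + 1) + 1) : ℂ) + Complex.I * (s : ℂ) = z := by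
    rw [rho_odd, hz]
    push_cast
    ring
  have hFm : Measurable fun t : ℝ => ((Real.cosh χ - t * Real.sinh χ : ℝ) : ℂ) ^ z := by fun_prop
  have hFc : ∀ θ : ℝ, ((Real.cosh χ - Real.cos θ * Real.sinh χ : ℝ) : ℂ) ^ z = horoPow z χ θ :=
    fun θ => (horoPow_eq_cpow z χ θ).symm
  have hc : Continuous fun θ : ℝ => horoPow z χ θ :=
    continuous_horoPow continuous_const continuous_const continuous_id
  obtain ⟨B, hB⟩ := (isCompact_Icc (a := (0 : ℝ)) (b := Real.pi)).exists_bound_of_continuousOn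
    hc.continuousOn
  have key := average_sphere_zonal_of_eq (show 2 * (j + 1) + 1 = (2 * j + 1) + 2 by ring) hFm (B := B)
    fun t ht => by
      rw [← Real.cos_arccos ht.1 ht.2, hFc]
      exact hB _ ⟨Real.arccos_nonneg _, Real.arccos_le_pi _⟩
  simp only [sphericalFunction, planeWave_polarPoint_single, hzr]
  rw [key]
  congr 1
  simp only [angularIntegral, hFc, mul_comm]
  rfl

lemma Gamma_add_nat {w : ℂ} (hw : ∀ n : ℕ, w ≠ -n) (k : ℕ) :
    Complex.Gamma (w + k) = (∏ i ∈ Finset.range k, (w + i)) * Complex.Gamma w := by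
  induction k with
  | zero => simp
  | succ k ih =>
    have h : w + k ≠ 0 := fun h => hw k (eq_neg_of_add_eq_zero_left h)
    rw [Nat.cast_succ, ← add_assoc, Complex.Gamma_add_one _ h, ih, Finset.prod_range_succ]
    ring

lemma Gamma_half_add_nat (k : ℕ) :
    Complex.Gamma ((k : ℂ) + 1 / 2)
      = (((∏ i ∈ Finset.range k, (2 * i + 1 : ℝ)) / 2 ^ k * √Real.pi : ℝ) : ℂ) := by
  have h : ∀ n : ℕ, (1 / 2 : ℂ) ≠ -n := fun n hn => by
    have := congrArg Complex.re hn
    norm_num at this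
    linarith [n.cast_nonneg (α := ℝ)]
  rw [add_comm, Gamma_add_nat h, Complex.Gamma_one_half_eq]
  have e : ∏ i ∈ Finset.range k, (1 / 2 + (i : ℂ)) = (∏ i ∈ Finset.range k, (2 * i + 1 : ℂ)) / 2 ^ k := by
    rw [eq_div_iff (pow_ne_zero _ two_ne_zero), ← Finset.card_range k, ← Finset.prod_const, Finset.card_range,
      ← Finset.prod_mul_distrib]
    refine Finset.prod_congr rfl fun i _ => ?_
    ring
  rw [e]
  push_cast
  congr 1
  rw [Real.sqrt_eq_rpow, Complex.ofReal_cpow Real.pi_pos.le]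
  norm_num

/-- The duplication formula merges the two Gamma factors into Γ(ρ + is). As ρ = j+1 is an integer,
this is a product of the factors is + i times Γ(is), and Γ(is) cancels. The factor i = 0 accounts
for s². -/
lemma inv_norm_cFunction_sq (j : ℕ) {s : ℝ} (hs : 0 < s) :
    (‖cFunction (2 * (j + 1) + 1) s‖ ^ 2)⁻¹
      = s ^ 2 * (∏ i ∈ Finset.range j, (s ^ 2 + (i + 1) ^ 2))
        / (4 ^ j * (∏ i ∈ Finset.range (j + 1), (2 * i + 1 : ℝ)) ^ 2) := by
  have hw : ∀ n : ℕ, Complex.I * (s : ℂ) ≠ -n := fun n hn => by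
    have := congrArg Complex.im hn
    simp at this
    linarith
  have hN : ‖Complex.Gamma (Complex.I * s)‖ ≠ 0 := norm_ne_zero_iff.2 (Complex.Gamma_ne_zero hw)
  have h2 : ∀ z : ℂ, ‖(2 : ℂ) ^ z‖ = (2 : ℝ) ^ z.re := fun z => by
    simpa using Complex.norm_cpow_eq_rpow_re_of_pos (x := 2) two_pos z
  have hP : ‖∏ i ∈ Finset.range (j + 1), (Complex.I * (s : ℂ) + i)‖ ^ 2
      = s ^ 2 * ∏ i ∈ Finset.range j, (s ^ 2 + (i + 1) ^ 2) := by
    rw [norm_prod, ← Finset.prod_pow, Finset.prod_range_succ', mul_comm]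
    congr 1
    · simp
    · refine Finset.prod_congr rfl fun i _ => ?_
      rw [← Complex.normSq_eq_norm_sq, Complex.normSq_apply]
      simp
      ring
  rw [cFunction, Complex.Gamma_mul_Gamma_add_half, rho_odd, mul_div_cancel₀ _ two_ne_zero,
    Complex.ofReal_natCast, Gamma_half_add_nat, add_comm _ (Complex.I * (s : ℂ)), Gamma_add_nat hw]
  simp only [norm_mul, norm_div, h2, Complex.norm_real]
  set P := ‖∏ i ∈ Finset.range (j + 1), (Complex.I * (s : ℂ) + i)‖
  set Q := ∏ i ∈ Finset.range (j + 1), (2 * i + 1 : ℝ) with hQ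
  have hQ0 : 0 < Q := Finset.prod_pos fun i _ => by positivity
  rw [← hP]
  have r1 : (((j + 1 : ℕ) : ℂ) - Complex.I * s).re = ((j + 1 : ℕ) : ℝ) := by simp
  have r2 : (1 - (Complex.I * s + (((j + 1 : ℕ)) : ℂ))).re = -(j : ℝ) := by simp
  rw [r1, r2, Real.rpow_natCast, Real.rpow_neg two_pos.le, Real.rpow_natCast,
    Real.norm_of_nonneg (by positivity), Real.norm_of_nonneg (Real.sqrt_nonneg _)]
  have hsq : √Real.pi ≠ 0 := (Real.sqrt_pos.2 Real.pi_pos).ne'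
  have h4 : (4 : ℝ) ^ j = (2 ^ j) ^ 2 := by
    rw [← pow_mul, mul_comm, pow_mul]
    norm_num
  rw [h4]
  field_simp
  rw [Real.norm_of_nonneg (pow_nonneg two_pos.le _)]

lemma integral_sin_pow_mul_prod (j : ℕ) :
    (∫ θ in (0 : ℝ)..Real.pi, (Real.sin θ : ℂ) ^ (2 * j + 1))
        * ∏ i ∈ Finset.range (j + 1), (2 * i + 1 : ℂ)
      = 2 * ∏ i ∈ Finset.range j, (2 * (i + 1) : ℂ) := by
  have e : (∫ θ in (0 : ℝ)..Real.pi, (Real.sin θ : ℂ) ^ (2 * j + 1))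
      = ((∫ θ in (0 : ℝ)..Real.pi, Real.sin θ ^ (2 * j + 1) : ℝ) : ℂ) := by
    rw [← intervalIntegral.integral_ofReal]
    simp
  rw [e, integral_sin_pow_odd, Finset.prod_range_succ']
  push_cast
  simp only [mul_zero, zero_add, mul_one]
  rw [mul_assoc, ← Finset.prod_mul_distrib]
  congr 1
  refine Finset.prod_congr rfl fun i _ => ?_
  have : (2 * i + 3 : ℂ) ≠ 0 := by exact_mod_cast (by positivity : (2 * i + 3 : ℕ) ≠ 0)
  field_simp
  ring

/-- Both sides contain the same polynomial in s and the same angular integral. The constants agree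
by the Wallis formula `integral_sin_pow_mul_prod`. -/
lemma sphericalFunction_mul_inv_norm_cFunction_sq (j : ℕ) {s : ℝ} (hs : 0 < s) (χ : ℝ) :
    sphericalFunction (2 * (j + 1) + 1) s χ
        * (((‖cFunction (2 * (j + 1) + 1) s‖ ^ 2)⁻¹ : ℝ) : ℂ)
      = (4 ^ j * ∏ i ∈ Finset.range (j + 1), (2 * i + 1 : ℂ))⁻¹ * iteratedCosine (j + 1) s χ := by
  rw [sphericalFunction_eq_angularIntegral, inv_norm_cFunction_sq j hs, iteratedCosine,
    Finset.prod_div_distrib]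
  have hI := integral_sin_pow_mul_prod j
  have hI0 := integral_sin_pow_ne_zero (2 * j + 1)
  have hT : (∏ i ∈ Finset.range j, (2 * (i + 1) : ℂ)) ≠ 0 := Finset.prod_ne_zero_iff.2 fun i _ => by
    exact_mod_cast (by positivity : (2 * (i + 1) : ℕ) ≠ 0)
  have hQ : (∏ i ∈ Finset.range (j + 1), (2 * i + 1 : ℂ)) ≠ 0 := Finset.prod_ne_zero_iff.2 fun i _ => by
    exact_mod_cast (by positivity : (2 * i + 1 : ℕ) ≠ 0)
  set W := ∫ θ in (0 : ℝ)..Real.pi, (Real.sin θ : ℂ) ^ (2 * j + 1)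
  push_cast
  set Q := ∏ i ∈ Finset.range (j + 1), (2 * i + 1 : ℂ)
  set T := ∏ i ∈ Finset.range j, (2 * (i + 1) : ℂ)
  have h4 : (4 : ℂ) ^ j ≠ 0 := pow_ne_zero _ (by norm_num)
  field_simp
  linear_combination -(angularIntegral j s χ * s ^ 2 * ∏ i ∈ Finset.range j, ((s : ℂ) ^ 2 + (i + 1) ^ 2)) * hI

/-- Negative M is kept apart: the oriented integral from 0 to M in `dirichletKernel_eq` need not
vanish there. -/
lemma dirichletKernel_of_neg (d : ℕ) [NeZero d] (R : ℝ) {M : ℝ} (hM : M < 0) (χ : ℝ) :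
    dirichletKernel d R M χ = 0 := by
  simp [dirichletKernel, inverseTransform, Icc_eq_empty (not_le.2 hM)]

lemma dirichletKernel_eq (j : ℕ) (R : ℝ) {M : ℝ} (hM : 0 ≤ M) (χ : ℝ) :
    dirichletKernel (2 * (j + 1) + 1) R M χ
      = 2 / (Real.pi * (R : ℂ) ^ (2 * (j + 1) + 1) * ∏ i ∈ Finset.range (j + 1), (2 * i + 1 : ℂ))
        * ∫ l in (0 : ℝ)..M, iteratedCosine (j + 1) l χ := by
  have e : ∫ s in Ioi (0 : ℝ), (Icc (0 : ℝ) M).indicator (fun _ => (1 : ℂ)) s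
        * sphericalFunction (2 * (j + 1) + 1) s χ
        * (((‖cFunction (2 * (j + 1) + 1) s‖ ^ 2)⁻¹ : ℝ) : ℂ)
      = ∫ s in Ioc (0 : ℝ) M, (4 ^ j * ∏ i ∈ Finset.range (j + 1), (2 * i + 1 : ℂ))⁻¹
        * iteratedCosine (j + 1) s χ := by
    rw [← integral_indicator measurableSet_Ioi, ← integral_indicator measurableSet_Ioc]
    congr 1
    ext s
    by_cases hs : s ∈ Ioi (0 : ℝ)
    · by_cases hsM : s ≤ M
      · have h1 : s ∈ Icc 0 M := ⟨(mem_Ioi.1 hs).le, hsM⟩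
        have h2 : s ∈ Ioc 0 M := ⟨hs, hsM⟩
        rw [indicator_of_mem hs, indicator_of_mem h1, indicator_of_mem h2, one_mul,
          sphericalFunction_mul_inv_norm_cFunction_sq j hs]
      · have h1 : s ∉ Icc 0 M := fun h => hsM h.2
        have h2 : s ∉ Ioc 0 M := fun h => hsM h.2
        rw [indicator_of_mem hs, indicator_of_notMem h1, indicator_of_notMem h2, zero_mul, zero_mul]
    · have h2 : s ∉ Ioc 0 M := fun h => hs h.1
      rw [indicator_of_notMem hs, indicator_of_notMem h2]
  rw [dirichletKernel, inverseTransform, e, integral_const_mul, ← intervalIntegral.integral_of_le hM,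
    rho_odd, ← mul_assoc]
  congr 1
  -- Here 2^(2ρ) = 4^(j+1), and 4^(j+1) / (2 · 4^j) gives the constant 2.
  have h2 : (2 : ℝ) ^ (2 * ((j + 1 : ℕ) : ℝ)) = 4 ^ (j + 1) := by
    rw [Real.rpow_mul (by norm_num), Real.rpow_natCast]
    norm_num
  rw [h2]
  push_cast
  have h4 : (4 : ℂ) ^ j ≠ 0 := pow_ne_zero _ (by norm_num)
  have hQ : (∏ i ∈ Finset.range (j + 1), (2 * i + 1 : ℂ)) ≠ 0 := Finset.prod_ne_zero_iff.2 fun i _ => by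
    exact_mod_cast (by positivity : (2 * i + 1 : ℕ) ≠ 0)
  set Q := ∏ i ∈ Finset.range (j + 1), (2 * i + 1 : ℂ)
  rw [← div_eq_mul_inv, div_div, pow_succ (4 : ℂ) j,
    show (4 : ℂ) ^ j * 4 = (4 ^ j * 2) * 2 by ring,
    show 2 * (Real.pi : ℂ) * R ^ (2 * (j + 1) + 1) * (4 ^ j * Q)
      = (4 ^ j * 2) * (Real.pi * R ^ (2 * (j + 1) + 1) * Q) by ring,
    mul_div_mul_left _ _ (mul_ne_zero h4 two_ne_zero)]

lemma continuous_dirichletKernel (j : ℕ) (R M : ℝ) :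
    Continuous (dirichletKernel (2 * (j + 1) + 1) R M) := by
  rcases lt_or_ge M 0 with hM | hM
  · rw [funext (dirichletKernel_of_neg (2 * (j + 1) + 1) R hM)]
    exact continuous_const
  · rw [funext (dirichletKernel_eq j R hM)]
    refine continuous_const.mul
      (intervalIntegral.continuous_parametric_intervalIntegral_of_continuous' ?_ _ _)
    have hswap : ∀ K : ℝ → ℝ → ℂ, Continuous (Function.uncurry K) →
        Continuous (Function.uncurry fun x l => K l x) := fun K hK => hK.comp continuous_swap
    exact hswap _ (continuous_iteratedCosine (j + 1))

end HypDirichlet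

end

/-! ### Integrability and the limit. -/

theorem proposition2 (k : ℕ) (hk : 1 ≤ k) (R : ℝ) (hR : 0 < R) (a : ℝ) (ha : 0 < a)
    (f : ℝ → ℂ) (hf : ContDiffOn ℝ ∞ f (Ioo 0 a))
    (L : ℕ → ℂ)
    (h_zero : ∀ m ≤ k, Tendsto (iteratedDeriv m f) (𝓝[>] 0) (𝓝 (L m)))
    (h_end : ∀ l < k, Tendsto (iteratedDeriv l f) (𝓝[<] a) (𝓝 0))
    (h_int : IntegrableOn (iteratedDeriv k f) (Ioo 0 a)) :
    (∀ M : ℝ, IntervalIntegrable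
      (fun χ : ℝ => f χ * HypDirichlet.dirichletKernel (2 * k + 1) R M χ
        * ((Real.sinh χ ^ (2 * k) : ℝ) : ℂ)) volume 0 a) ∧
    Tendsto (fun M : ℝ => ((R ^ (2 * k + 1) : ℝ) : ℂ) *
        ∫ χ in (0 : ℝ)..a, f χ * HypDirichlet.dirichletKernel (2 * k + 1) R M χ
          * ((Real.sinh χ ^ (2 * k) : ℝ) : ℂ))
      atTop (𝓝 (L 0)) := by
  obtain ⟨j, rfl⟩ : ∃ j, k = j + 1 := ⟨k - 1, by omega⟩
  have hreg := HypDirichlet.regularUpTo_of_contDiffOn hf h_zero h_end h_int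
  have hL : Tendsto f (𝓝[>] 0) (𝓝 (L 0)) := by simpa using h_zero 0 (Nat.zero_le _)
  constructor
  · intro M
    have hc := HypDirichlet.continuous_dirichletKernel j R M
    rw [intervalIntegrable_iff_integrableOn_Ioo_of_le ha.le]
    simp only [mul_assoc]
    exact hreg.integrableOn.mul_continuousOn_of_subset (Continuous.continuousOn (by fun_prop))
      measurableSet_Ioo isCompact_Icc Ioo_subset_Icc_self
  · have key := HypDirichlet.tendsto_integral_integral_iteratedCosine ha hk hreg hL
    have hQ : (∏ i ∈ Finset.range (j + 1), (2 * i + 1 : ℂ)) ≠ 0 :=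
      Finset.prod_ne_zero_iff.2 fun i _ => by
        exact_mod_cast (by positivity : (2 * i + 1 : ℕ) ≠ 0)
    have hpi : (Real.pi : ℂ) ≠ 0 := by exact_mod_cast Real.pi_ne_zero
    have hRc : (R : ℂ) ≠ 0 := by exact_mod_cast hR.ne'
    have key2 := key.const_mul (2 / (Real.pi * ∏ i ∈ Finset.range (j + 1), (2 * i + 1 : ℂ)))
    have hlim : 2 / (Real.pi * ∏ i ∈ Finset.range (j + 1), (2 * i + 1 : ℂ))
        * (Real.pi / 2 * ((∏ i ∈ Finset.range (j + 1), (2 * i + 1 : ℂ)) * L 0)) = L 0 := by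
      set Q := ∏ i ∈ Finset.range (j + 1), (2 * i + 1 : ℂ)
      field_simp
    rw [hlim] at key2
    refine key2.congr' ?_
    -- The closed form of the kernel holds only for M ≥ 0. Its factor R^(-d) cancels the R^d in
    -- front.
    filter_upwards [eventually_ge_atTop 0] with M hM
    rw [intervalIntegral.integral_of_le ha.le, integral_Ioc_eq_integral_Ioo, ← integral_const_mul,
      ← integral_const_mul]
    congr 1
    ext x
    rw [HypDirichlet.dirichletKernel_eq j R hM]
    push_cast
    set Q := ∏ i ∈ Finset.range (j + 1), (2 * i + 1 : ℂ)
    field_simp
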